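/- Let $\Sigma$ be a finite alphabet and $k,k'\ge 1$. A hyperproperty over $\Sigma$ is a set $\mathbf S\subseteq\mathcal P(\Sigma^\omega)$. For $T\subseteq\Sigma^*$ and $T'\subseteq\Sigma^\omega$ write $T\le T'$ if every $t\in T$ is a prefix of some $t'\in T'$. A set $T\subseteq\Sigma^*$ is a bad prefix of $\mathbf S$ if $T'\notin\mathbf S$ for all $T'\subseteq\Sigma^\omega$ with $T\le T'$; and $\mathbf S$ is a $j$-safety hyperproperty if for every $T'\notin\mathbf S$ there is a bad prefix $T$ of $\mathbf S$ with $T\le T'$ and $|T|\le j$. For a word $\sigma\in(\Sigma^k)^*$ let $\mathrm{unzip}(\sigma)\subseteq\Sigma^*$ be the set of its $k$ component words. A finite automaton $\mathcal A$ over $\Sigma^k$ is a ($k$-)bad-prefix automaton for $\mathbf S$ if $\mathrm{unzip}(\sigma)$ is a bad prefix of $\mathbf S$ for every $\sigma\in L(\mathcal A)$, and for all $T\subseteq\Sigma^\omega$: $T\notin\mathbf S$ if and only if $\mathrm{unzip}(\sigma)\le T$ for some $\sigma\in L(\mathcal A)$. For deterministic finite automata $\mathcal A_k$ over $\Sigma^k$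 and $\mathcal A_{k'}$ over $\Sigma^{k'}$ (in which a state has at most one successor for each letter), $\mathcal A_k\equiv\mathcal A_{k'}$ (representation-equivalence) means that, for some $j\le\min(k,k')$, both are bad-prefix automata for the same $j$-safety hyperproperty. Let $|\mathcal A|$ be the number of states of $\mathcal A$. Algorithms are programs of a random access machine with a read-only input (which consists of $|\Sigma|$, $k$, $k'$ and the tables of the two automata); time is the number of elementary steps, and space is the number of memory words used. Then representation-equivalence is decidable, by programs that work for all $\Sigma,k,k'$, as follows. (1) There is a deterministic program that decides whether $\mathcal A_k\equiv\mathcal A_{k'}$ in time $\mathrm{poly}(|\mathcal A_k|+|\mathcal A_{k'}|)$, with words of value at most $\mathrm{poly}(|\mathcal A_k|+|\mathcal A_{k'}|)$, where the polynomial may depend on $|\Sigma|$, $k$ and $k'$. (2) There is a nondeterministic program, all of whose runs halt and which has a run that ends with the answer "no" if and only if $\mathcal A_k\not\equiv\mathcal A_{k'}$, all of whose runs take at the same time only time $\mathrm{poly}(|\mathcal A_k|+|\mathcal A_{k'}|)$, where the polynomial may depend on $|\Sigma|$, $k$ and $k'$, and space $2^{O(\max(\log k,\log k')\cdot\max(k,k'))}$,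 that is, at most $C\cdot 2^{C\max(\log_2 k,\log_2 k')\max(k,k')}$ words with an absolute constant $C$; each word has a value at most $(N+m^m)^C$, where $N$ is the length of the input and $m=\max(k,k')$. -/

import Mathlib

namespace HyperAut

section Hyperproperties

variable {α : Type*}

/-- The finite trace `t` is a prefix of the infinite trace `τ`. -/
def IsPrefix (t : List α) (τ : ℕ → α) : Prop :=
  ∀ (i : ℕ) (h : i < t.length), t[i] = τ i

/-- The prefix relation `T ≤ T'` between a set of finite traces and a set of infinite traces. -/
def SetPrefix (T : Set (List α)) (T' : Set (ℕ → α)) : Prop :=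
  ∀ t ∈ T, ∃ t' ∈ T', IsPrefix t t'

/-- The bad prefixes of a hyperproperty `S` (a set of sets of infinite traces). -/
def bad (S : Set (Set (ℕ → α))) : Set (Set (List α)) :=
  {T | ∀ T' : Set (ℕ → α), SetPrefix T T' → T' ∉ S}

/-- The bad prefixes that consist of at most `k` traces. -/
def badK (S : Set (Set (ℕ → α))) (k : ℕ) : Set (Set (List α)) :=
  {T | T ∈ bad S ∧ T.encard ≤ k}

/-- Hypersafety: every violating set of traces has a (finite) bad prefix. -/
def IsHypersafety (S : Set (Set (ℕ → α))) : Prop :=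
  ∀ T' : Set (ℕ → α), T' ∉ S → ∃ T : Set (List α), T.Finite ∧ SetPrefix T T' ∧ T ∈ bad S

/-- `k`-safety hyperproperties. -/
def IsKSafety (k : ℕ) (S : Set (Set (ℕ → α))) : Prop :=
  IsHypersafety S ∧ ∀ T' : Set (ℕ → α), T' ∉ S → ∃ T ∈ badK S k, SetPrefix T T'

/-- The set of the `k` component traces of a word over `k`-tuples. -/
def unzip {k : ℕ} (σ : List (Fin k → α)) : Set (List α) :=
  Set.range fun i : Fin k => σ.map fun v => v i

/-- `L` is a `k`-representation of `S`: its words represent bad prefixes of `S`, and a set of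
traces violates `S` iff one of these bad prefixes is a prefix of it. -/
def IsRepresentation {k : ℕ} (L : Language (Fin k → α)) (S : Set (Set (ℕ → α))) : Prop :=
  (∀ σ ∈ L, unzip σ ∈ bad S) ∧
    ∀ T : Set (ℕ → α), T ∉ S ↔ ∃ σ ∈ L, SetPrefix (unzip σ) T ∧ unzip σ ∈ bad S

end Hyperproperties

section Automata

/-- A deterministic finite automaton over the alphabet `α` with the `n` states `Fin n`:
in each state there is at most one successor for each letter. -/
structure DetAut (α : Type*) (n : ℕ) where
  start : Fin n
  step : Fin n → α → Option (Fin n)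
  accept : Fin n → Bool

variable {α : Type*}

/-- The automaton as a nondeterministic automaton. -/
def DetAut.toNFA {n : ℕ} (A : DetAut α n) : NFA α (Fin n) where
  step q a := {q' | A.step q a = some q'}
  start := {A.start}
  accept := {q | A.accept q = true}

/-- `A` is a `k`-bad-prefix automaton for the hyperproperty `S`. -/
def IsBadPrefixAut {k n : ℕ} (A : DetAut (Fin k → α) n) (S : Set (Set (ℕ → α))) : Prop :=
  IsRepresentation A.toNFA.accepts S

/-- Representation-equivalence: both automata are bad-prefix automata for the same `j`-safety
hyperproperty, for some `j` that is at most both arities. -/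
def RepEquiv {k k' n n' : ℕ} (A : DetAut (Fin k → α) n) (A' : DetAut (Fin k' → α) n') : Prop :=
  ∃ j : ℕ, j ≤ k ∧ j ≤ k' ∧ ∃ S : Set (Set (ℕ → α)),
    IsKSafety j S ∧ IsBadPrefixAut A S ∧ IsBadPrefixAut A' S

end Automata

section Machine

/-- Work memory of a random access machine: a word in each cell. -/
abbrev Mem := ℕ → ℕ

/-- Elementary instructions; the arguments are addresses of memory cells (`c` is a constant). -/
inductive Instr where
  | const (i c : ℕ)
  | add (i j l : ℕ)
  | sub (i j l : ℕ)
  | mul (i j l : ℕ)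
  | div (i j l : ℕ)
  | mod (i j l : ℕ)
  | load (i j : ℕ)
  | store (i j : ℕ)
  | input (i j : ℕ)
  | guess (i j : ℕ)

/-- The possible memories after executing one instruction; `inp` is the read-only input.
`load` and `store` are indirect, `input i j` reads the entry of the input whose position is in
cell `j`, and `guess i j` puts an arbitrary number `v ≤ M j` into cell `i`. -/
def Instr.exec (inp : List ℕ) : Instr → Mem → Set Mem
  | .const i c, M => {Function.update M i c}
  | .add i j l, M => {Function.update M i (M j + M l)}
  | .sub i j l, M => {Function.update M i (M j - M l)}
  | .mul i j l, M => {Function.update M i (M j * M l)}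
  | .div i j l, M => {Function.update M i (M j / M l)}
  | .mod i j l, M => {Function.update M i (M j % M l)}
  | .load i j, M => {Function.update M i (M (M j))}
  | .store i j, M => {Function.update M (M i) (M j)}
  | .input i j, M => {Function.update M i (inp.getD (M j) 0)}
  | .guess i j, M => {M' | ∃ v, v ≤ M j ∧ M' = Function.update M i v}

/-- Programs; `ite i p q` and `loop i p` (a while loop) test whether cell `i` is nonzero. -/
inductive Prog where
  | instr (a : Instr)
  | seq (p q : Prog)
  | ite (i : ℕ) (p q : Prog)
  | loop (i : ℕ) (p : Prog)

/-- The program contains no `guess`. -/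
def Prog.Deterministic : Prog → Prop
  | .instr (.guess _ _) => False
  | .instr _ => True
  | .seq p q => p.Deterministic ∧ q.Deterministic
  | .ite _ p q => p.Deterministic ∧ q.Deterministic
  | .loop _ p => p.Deterministic

/-- The parts of the program still to be executed, and the memory.
The machine has halted when the list is empty. -/
abbrev Config := List Prog × Mem

/-- The possible successors of a configuration in one step. -/
def Config.next (inp : List ℕ) : Config → Set Config
  | ([], _) => ∅
  | (.instr a :: K, M) => {c | ∃ M' ∈ a.exec inp M, c = (K, M')}
  | (.seq p q :: K, M) => {(p :: q :: K, M)}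
  | (.ite i p q :: K, M) => {(if M i ≠ 0 then p :: K else q :: K, M)}
  | (.loop i p :: K, M) => {(if M i ≠ 0 then p :: .loop i p :: K else K, M)}

/-- `Run P inp t c`: the program `P` started on the input `inp`, with all memory cells zero,
can be in the configuration `c` after exactly `t` steps. -/
inductive Run (P : Prog) (inp : List ℕ) : ℕ → Config → Prop where
  | init : Run P inp 0 ([P], fun _ => 0)
  | step {t : ℕ} {c c' : Config} : Run P inp t c → c' ∈ Config.next inp c → Run P inp (t + 1) c'

/-- Every run has at most `t` steps; as every configuration that has not halted has a
successor, every run then halts. -/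
def HaltsWithin (P : Prog) (inp : List ℕ) (T : ℕ) : Prop :=
  ∀ t c, Run P inp t c → t ≤ T

/-- At all times, all memory cells contain numbers at most `W`. -/
def WordsAtMost (P : Prog) (inp : List ℕ) (W : ℕ) : Prop :=
  ∀ t c, Run P inp t c → ∀ a, c.2 a ≤ W

/-- At all times, all memory cells other than the first `B` ones are unused. -/
def SpaceAtMost (P : Prog) (inp : List ℕ) (B : ℝ) : Prop :=
  ∀ t c, Run P inp t c → ∀ a : ℕ, B ≤ (a : ℝ) → c.2 a = 0

/-- Every halting run ends with the answer "yes", a nonzero number in cell `0`. For a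
deterministic program there is at most one halting run. For a program with `guess` this is the
usual convention for a search for a counterexample: "no" is the answer iff some run finds one. -/
def AnswersYes (P : Prog) (inp : List ℕ) : Prop :=
  ∀ t M, Run P inp t ([], M) → M 0 ≠ 0

end Machine

section Encoding

/-- The automaton as a list of numbers: number of states, initial state, the table of accepting
states, and the transition table. The entry for the state `q` and the letter `v` has position
`q * s ^ k + ∑ i, v i * s ^ i` in the transition table, and is `n` if there is no transition. -/
def encodeAut {s k n : ℕ} (A : DetAut (Fin k → Fin s) n) : List ℕ :=
  n :: (A.start : ℕ) ::
    ((List.ofFn fun q : Fin n => if A.accept q then 1 else 0) ++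
      List.ofFn fun i : Fin (n * s ^ k) =>
        ((A.step (finProdFinEquiv.symm i).1
          (finFunctionFinEquiv.symm (finProdFinEquiv.symm i).2)).map Fin.val).getD n)

/-- The input for a pair of automata over `k`- and `k'`-tuples of letters from `Fin s`. -/
def encodeInput {s k k' n n' : ℕ} (A : DetAut (Fin k → Fin s) n)
    (A' : DetAut (Fin k' → Fin s) n') : List ℕ :=
  s :: k :: k' :: (encodeAut A ++ encodeAut A')

end Encoding

end HyperAut

/-!
Both automata represent the same hyperproperty iff neither has a counterexample: an infinite word
`τ` with a prefix accepted by the one, such that no word obtained from `τ` by copying its components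
has a prefix accepted by the other. Run on `τ` the first automaton together with `k ^ k'` copies of
the second, one for each way of choosing the components. In this product a counterexample is an
infinite walk along which no copy ever accepts, and which reaches a state where the first automaton
has accepted. As there are finitely many states, say `V`, it exists iff there is a walk of `V` steps
to such a state that can be extended by another `V` steps.

The deterministic program computes, for growing `t`, the table of the states from which `t` steps
are possible; for fixed `s`, `k`, `k'` the number of states is a polynomial. The nondeterministic
one guesses the walk on the fly. It keeps one state of the product, which takes `k ^ k' + 1` words,
and counts the steps in a numeral with about as many digits, to a base linear in the numbers of
states, so that neither space nor the values of words depend on `V`.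

Both are obtained by translation from a structured language. Its weakest preconditions, read for all
guesses or for some guess, include the bounds on words, space and time.
-/

namespace HyperAut

section Counterexamples

variable {α : Type*} {k k' : ℕ}

theorem isPrefix_iff {t : List α} {τ : ℕ → α} :
    IsPrefix t τ ↔ t = (List.range t.length).map τ := by
  constructor
  · intro h
    refine List.ext_getElem (by simp) fun i hi _ => ?_
    simpa using h i hi
  · intro h i hi
    rw [List.getElem_of_eq h]
    simp

theorem exists_isPrefix_iff {L : Language α} {τ : ℕ → α} :
    (∃ σ ∈ L, IsPrefix σ τ) ↔ ∃ i, (List.range i).map τ ∈ L := by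
  constructor
  · rintro ⟨σ, hσ, h⟩
    exact ⟨σ.length, isPrefix_iff.1 h ▸ hσ⟩
  · rintro ⟨i, hi⟩
    exact ⟨_, hi, isPrefix_iff.2 (by simp)⟩

theorem setPrefix_unzip_iff {σ : List (Fin k → α)} {T : Set (ℕ → α)} :
    SetPrefix (unzip σ) T ↔ ∃ t : Fin k → ℕ → α, (∀ i, t i ∈ T) ∧ IsPrefix σ fun n i => t i n := by
  simp only [SetPrefix, unzip, Set.forall_mem_range, IsPrefix, List.length_map, List.getElem_map,
    funext_iff]
  constructor
  · intro h
    choose t ht hp using h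
    exact ⟨t, ht, fun j hj i => hp i j hj⟩
  · rintro ⟨t, ht, hp⟩ i
    exact ⟨t i, ht i, fun j hj => hp j hj i⟩

/-- The set of traces `T` extends a bad prefix that is represented by a word of `L`. -/
def Violates (L : Language (Fin k → α)) (T : Set (ℕ → α)) : Prop :=
  ∃ σ ∈ L, SetPrefix (unzip σ) T

/-- A witness that a set of at most `k` traces violates `L` but not `L'`: the traces are the
components of an infinite word that has a prefix in `L`, while no choice of `k'` of its components,
which may repeat some of them, yields a word with a prefix in `L'`. -/
def Counterexample (L : Language (Fin k → α)) (L' : Language (Fin k' → α)) : Prop :=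
  ∃ τ : ℕ → Fin k → α, (∃ σ ∈ L, IsPrefix σ τ) ∧
    ∀ f : Fin k' → Fin k, ¬ ∃ σ ∈ L', IsPrefix σ fun n => τ n ∘ f

theorem forall_violates_iff_not_counterexample {L : Language (Fin k → α)}
    {L' : Language (Fin k' → α)} :
    (∀ T, Violates L T → Violates L' T) ↔ ¬ Counterexample L L' := by
  constructor
  · rintro h ⟨τ, ⟨σ, hσ, hτ⟩, hf⟩
    obtain ⟨σ', hσ', hT⟩ := h (Set.range fun i n => τ n i)
      ⟨σ, hσ, setPrefix_unzip_iff.2 ⟨fun i n => τ n i, Set.mem_range_self, hτ⟩⟩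
    obtain ⟨t, ht, hp⟩ := setPrefix_unzip_iff.1 hT
    choose f htf using ht
    obtain rfl : (fun i n => τ n (f i)) = t := funext htf
    exact hf f ⟨σ', hσ', hp⟩
  · rintro h T ⟨σ, hσ, hT⟩
    obtain ⟨t, ht, hp⟩ := setPrefix_unzip_iff.1 hT
    by_contra hv
    exact h ⟨fun n i => t i n, ⟨σ, hσ, hp⟩, fun f ⟨σ', hσ', hp'⟩ =>
      hv ⟨σ', hσ', setPrefix_unzip_iff.2 ⟨fun i => t (f i), fun i => ht _, hp'⟩⟩⟩

theorem unzip_mem_bad {L : Language (Fin k → α)} {σ : List (Fin k → α)} (hσ : σ ∈ L) :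
    unzip σ ∈ bad {T | ¬ Violates L T} :=
  fun _ hT h => h ⟨σ, hσ, hT⟩

theorem isRepresentation_iff {L : Language (Fin k → α)} {S : Set (Set (ℕ → α))} :
    IsRepresentation L S ↔ S = {T | ¬ Violates L T} := by
  constructor
  · rintro ⟨hbad, hmem⟩
    ext T
    rw [Set.mem_ofPred_eq, ← not_iff_not, hmem T, not_not]
    exact ⟨fun ⟨σ, hσ, hT, _⟩ => ⟨σ, hσ, hT⟩, fun ⟨σ, hσ, hT⟩ => ⟨σ, hσ, hT, hbad σ hσ⟩⟩
  · rintro rfl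
    refine ⟨fun σ => unzip_mem_bad, fun T => ?_⟩
    rw [Set.mem_ofPred_eq, not_not]
    exact ⟨fun ⟨σ, hσ, hT⟩ => ⟨σ, hσ, hT, unzip_mem_bad hσ⟩, fun ⟨σ, hσ, hT, _⟩ => ⟨σ, hσ, hT⟩⟩

theorem isKSafety_setOf_not_violates (L : Language (Fin k → α)) :
    IsKSafety k {T | ¬ Violates L T} := by
  refine ⟨fun T hT => ?_, fun T hT => ?_⟩ <;> obtain ⟨σ, hσ, h⟩ := not_not.1 hT
  · exact ⟨unzip σ, Set.finite_range _, h, unzip_mem_bad hσ⟩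
  · refine ⟨unzip σ, ⟨unzip_mem_bad hσ, ?_⟩, h⟩
    rw [unzip, ← Set.image_univ]
    exact (Set.encard_image_le _ _).trans (by simp)

theorem repEquiv_iff {n n' : ℕ} {A : DetAut (Fin k → α) n} {A' : DetAut (Fin k' → α) n'} :
    RepEquiv A A' ↔ ¬ Counterexample A.toNFA.accepts A'.toNFA.accepts ∧
      ¬ Counterexample A'.toNFA.accepts A.toNFA.accepts := by
  simp only [← forall_violates_iff_not_counterexample, RepEquiv, IsBadPrefixAut,
    isRepresentation_iff]
  constructor
  · rintro ⟨j, -, -, S, -, rfl, h⟩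
    have violates_iff T := not_iff_not.1 (Set.ext_iff.1 h T)
    exact ⟨fun T => (violates_iff T).1, fun T => (violates_iff T).2⟩
  · rintro ⟨h, h'⟩
    have heq : {T | ¬ Violates A.toNFA.accepts T} = {T | ¬ Violates A'.toNFA.accepts T} :=
      Set.ext fun T => not_congr ⟨h T, h' T⟩
    rcases le_total k k' with hk | hk
    · exact ⟨k, le_rfl, hk, _, isKSafety_setOf_not_violates _, rfl, heq⟩
    · exact ⟨k', hk, le_rfl, _, isKSafety_setOf_not_violates _, heq.symm, rfl⟩

end Counterexamples

section Walks

variable {X : Type*} {R : X → X → Prop} {m n : ℕ} {x y z : X}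

/-- There is a walk with `n` steps from `x` to `y` in the graph of the relation `R`. -/
def Walk (R : X → X → Prop) : ℕ → X → X → Prop
  | 0, x, y => x = y
  | n + 1, x, z => ∃ y, R x y ∧ Walk R n y z

theorem Walk.append (hxy : Walk R m x y) (hyz : Walk R n y z) : Walk R (m + n) x z := by
  induction m generalizing x with
  | zero => cases hxy; rwa [zero_add]
  | succ m ih =>
    obtain ⟨w, hxw, hwy⟩ := hxy
    rw [Nat.succ_add]
    exact ⟨w, hxw, ih hwy⟩

theorem Walk.snoc (hxy : Walk R n x y) (hyz : R y z) : Walk R (n + 1) x z :=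
  hxy.append ⟨z, hyz, rfl⟩

theorem walk_of_forall_rel {w : ℕ → X} {i n : ℕ} (hw : ∀ j < n, R (w (i + j)) (w (i + j + 1))) :
    Walk R n (w i) (w (i + n)) := by
  induction n with
  | zero => rfl
  | succ n ih => exact (ih fun j hj => hw j (by omega)).snoc (hw n (by omega))

theorem Walk.exists_prepend {u : ℕ → X} (h : Walk R n x (u 0)) :
    ∃ w : ℕ → X, w 0 = x ∧ (∀ i < n, R (w i) (w (i + 1))) ∧ ∀ i, w (n + i) = u i := by
  induction n generalizing x with
  | zero => exact ⟨u, h.symm, by simp, by simp⟩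
  | succ n ih =>
    obtain ⟨y, hxy, hyu⟩ := h
    obtain ⟨w, rfl, hw, hwu⟩ := ih hyu
    refine ⟨fun i => Nat.casesOn i x w, rfl, fun i hi => ?_, fun i => ?_⟩
    · cases i with
      | zero => exact hxy
      | succ i => exact hw i (by omega)
    · rw [Nat.succ_add]
      exact hwu i

theorem Walk.exists_cycle [Fintype X] (hn : Fintype.card X ≤ n) (h : Walk R n x y) :
    ∃ a b c z, a + (b + 1) + c = n ∧ Walk R a x z ∧ Walk R (b + 1) z z ∧ Walk R c z y := by
  obtain ⟨w, rfl, hw, hy⟩ := h.exists_prepend (u := fun _ => y)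
  obtain rfl : w n = y := hy 0
  obtain ⟨i, j, hij, hwij⟩ : ∃ i j : Fin (n + 1), i < j ∧ w i = w j := by
    obtain ⟨i, j, hne, h⟩ := Fintype.exists_ne_map_eq_of_card_lt
      (fun i : Fin (n + 1) => w i) (by simpa using Nat.lt_succ_of_le hn)
    exact hne.lt_or_gt.elim (fun hlt => ⟨i, j, hlt, h⟩) fun hlt => ⟨j, i, hlt, h.symm⟩
  obtain ⟨b, hb⟩ := Nat.exists_eq_add_of_lt (Fin.lt_def.1 hij)
  obtain ⟨c, hc⟩ := Nat.exists_eq_add_of_le (Nat.le_of_lt_succ j.isLt)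
  have segment (l m : ℕ) (hlm : l + m ≤ n) : Walk R m (w l) (w (l + m)) :=
    walk_of_forall_rel fun t ht => hw (l + t) (by omega)
  refine ⟨i, b, c, w i, by omega, ?_, ?_, ?_⟩
  · simpa using segment 0 i (by omega)
  · simpa [← add_assoc, ← hb, ← hwij] using segment i (b + 1) (by omega)
  · simpa [← hc, ← hwij] using segment j c (by omega)

theorem Walk.exists_le_card [Fintype X] (h : Walk R n x y) :
    ∃ m ≤ Fintype.card X, Walk R m x y := by
  induction n using Nat.strong_induction_on with
  | _ n ih =>
    rcases le_total n (Fintype.card X) with hn | hn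
    · exact ⟨n, hn, h⟩
    · obtain ⟨a, b, c, z, rfl, hxz, -, hzy⟩ := h.exists_cycle hn
      exact ih (a + c) (by omega) (hxz.append hzy)

theorem exists_forall_rel_of_forall_exists {G : Set X} (hG : ∀ x ∈ G, ∃ y ∈ G, R x y) (hx : x ∈ G) :
    ∃ w : ℕ → X, w 0 = x ∧ ∀ i, R (w i) (w (i + 1)) := by
  choose next hmem hrel using hG
  let w : ℕ → G := fun i => Nat.rec ⟨x, hx⟩ (fun _ y => ⟨next y y.2, hmem y y.2⟩) i
  exact ⟨fun i => (w i).1, rfl, fun i => hrel (w i).1 (w i).2⟩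

theorem Walk.exists_forall_rel [Fintype X] (hn : Fintype.card X ≤ n) (h : Walk R n x y) :
    ∃ w : ℕ → X, w 0 = x ∧ ∀ i, R (w i) (w (i + 1)) := by
  obtain ⟨a, b, -, z, -, hxz, hzz, -⟩ := h.exists_cycle hn
  refine exists_forall_rel_of_forall_exists (G := {u | ∃ m, Walk R (m + 1) u z}) ?_
    ⟨a + b, hxz.append hzz⟩
  rintro u ⟨_ | m, v, huv, hvz⟩
  · obtain rfl : v = z := hvz
    exact ⟨v, ⟨b, hzz⟩, huv⟩
  · exact ⟨v, ⟨m, hvz⟩, huv⟩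

theorem exists_forall_rel_and_exists_iff [Fintype X] {Acc : X → Prop}
    (hAcc : ∀ x y, R x y → Acc x → Acc y) {l : ℕ} (hl : Fintype.card X ≤ l) :
    (∃ w : ℕ → X, w 0 = x ∧ (∀ i, R (w i) (w (i + 1))) ∧ ∃ i, Acc (w i)) ↔
      ∃ y z, Walk R l x y ∧ Acc y ∧ Walk R l y z := by
  constructor
  · rintro ⟨w, rfl, hw, i, hi⟩
    obtain ⟨m, hm, hmi⟩ := Walk.exists_le_card
      (by simpa using walk_of_forall_rel (i := 0) (n := i) fun j _ => hw (0 + j))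
    have acc_add (j : ℕ) : Acc (w (i + j)) := by
      induction j with
      | zero => exact hi
      | succ j ih => exact hAcc _ _ (hw _) ih
    refine ⟨w (i + (l - m)), _, ?_, acc_add _, walk_of_forall_rel fun j _ => hw _⟩
    rw [← Nat.add_sub_of_le (hm.trans hl)]
    simpa using hmi.append (walk_of_forall_rel fun j _ => hw _)
  · rintro ⟨y, z, hxy, hy, hyz⟩
    obtain ⟨u, rfl, hu⟩ := hyz.exists_forall_rel hl
    obtain ⟨w, hwx, hw, hwu⟩ := hxy.exists_prepend
    refine ⟨w, hwx, fun i => ?_, l, by rwa [← Nat.add_zero l, hwu]⟩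
    rcases lt_or_ge i l with hi | hi
    · exact hw i hi
    · obtain ⟨j, rfl⟩ := Nat.exists_eq_add_of_le hi
      rw [add_assoc, hwu, hwu]
      exact hu j

end Walks

section Product

variable {α : Type*} {k k' n n' : ℕ}

/-- The state of the automaton after reading a word, or `none` if the run breaks off. -/
def DetAut.run (A : DetAut α n) (σ : List α) : Option (Fin n) :=
  σ.foldl (fun o a => o.bind fun q => A.step q a) (some A.start)

theorem DetAut.run_append_singleton (A : DetAut α n) (σ : List α) (a : α) :
    A.run (σ ++ [a]) = (A.run σ).bind fun q => A.step q a := by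
  simp [run]

theorem DetAut.mem_eval_iff {A : DetAut α n} {σ : List α} {q : Fin n} :
    q ∈ A.toNFA.eval σ ↔ A.run σ = some q := by
  induction σ using List.reverseRecOn generalizing q with
  | nil =>
    simp only [NFA.eval_nil, run, List.foldl_nil, Option.some.injEq]
    exact eq_comm
  | append_singleton σ a ih =>
    simp only [NFA.eval_append_singleton, NFA.mem_stepSet, run_append_singleton, ih,
      Option.bind_eq_some_iff]
    rfl

theorem DetAut.mem_accepts_iff {A : DetAut α n} {σ : List α} :
    σ ∈ A.toNFA.accepts ↔ ∃ q, A.run σ = some q ∧ A.accept q = true := by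
  rw [NFA.mem_accepts]
  exact exists_congr fun q => and_comm.trans (and_congr_left' mem_eval_iff)

/-- The states of the product of an automaton over `k`-tuples, which is watched for acceptance,
with one copy of an automaton over `k'`-tuples for each choice of `k'` of the `k` components.
A copy is in the state `none` if its run has broken off. The first component is `none` once the
watched automaton has accepted a prefix, and until then `some o` for the state `o` of its run. -/
abbrev ProdState (k k' n n' : ℕ) : Type :=
  Option (Option (Fin n)) × ((Fin k' → Fin k) → Option (Fin n'))

/-- The transitions of the first component of the product. -/
def watchStep (A : DetAut α n) (a : α) : Option (Option (Fin n)) → Option (Option (Fin n))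
  | none => none
  | some none => some none
  | some (some q) => if A.accept q then none else some (A.step q a)

/-- The transition function of the product. -/
def prodStep (A : DetAut (Fin k → α) n) (B : DetAut (Fin k' → α) n') (x : ProdState k k' n n')
    (v : Fin k → α) : ProdState k k' n n' :=
  (watchStep A v x.1, fun f => (x.2 f).bind fun q => B.step q (v ∘ f))

/-- The initial state of the product. -/
def prodStart (A : DetAut (Fin k → α) n) (B : DetAut (Fin k' → α) n') : ProdState k k' n n' :=
  (some (some A.start), fun _ => some B.start)

/-- Some copy of the second automaton accepts, so that the word read so far does not extend to a
counterexample. -/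
def ProdBad (B : DetAut (Fin k' → α) n') (x : ProdState k k' n n') : Prop :=
  ∃ f q, x.2 f = some q ∧ B.accept q = true

/-- One step of the search for a counterexample: a transition of the product from a state in which
no copy accepts. -/
def ProdRel (A : DetAut (Fin k → α) n) (B : DetAut (Fin k' → α) n') (x y : ProdState k k' n n') :
    Prop :=
  ¬ ProdBad B x ∧ ∃ v, prodStep A B x v = y

variable {A : DetAut (Fin k → α) n} {B : DetAut (Fin k' → α) n'} {w : ℕ → ProdState k k' n n'}
  {τ : ℕ → Fin k → α}

theorem prodBad_iff_exists_mem_accepts (h0 : w 0 = prodStart A B)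
    (hw : ∀ i, prodStep A B (w i) (τ i) = w (i + 1)) (i : ℕ) :
    ProdBad B (w i) ↔ ∃ f : Fin k' → Fin k,
      (List.range i).map (fun j => τ j ∘ f) ∈ B.toNFA.accepts := by
  have copy_eq_run (f : Fin k' → Fin k) :
      (w i).2 f = B.run ((List.range i).map fun j => τ j ∘ f) := by
    induction i with
    | zero => rw [h0]; rfl
    | succ i ih =>
      simp only [List.range_succ, List.map_append, List.map_singleton, DetAut.run_append_singleton,
        ← ih, ← hw, prodStep]
  simp only [ProdBad, DetAut.mem_accepts_iff, copy_eq_run]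

open Classical in
theorem watch_eq_ite (h0 : w 0 = prodStart A B)
    (hw : ∀ i, prodStep A B (w i) (τ i) = w (i + 1)) (i : ℕ) :
    (w i).1 = if ∃ j < i, (List.range j).map τ ∈ A.toNFA.accepts then none
      else some (A.run ((List.range i).map τ)) := by
  induction i with
  | zero => simp [h0, prodStart, DetAut.run]
  | succ i ih =>
    simp only [← hw, prodStep, ih, List.range_succ, List.map_append, List.map_singleton,
      DetAut.run_append_singleton, Nat.lt_succ_iff_lt_or_eq, or_and_right, exists_or,
      exists_eq_left, DetAut.mem_accepts_iff (σ := (List.range i).map τ)]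
    by_cases hacc : ∃ j < i, (List.range j).map τ ∈ A.toNFA.accepts
    · simp [hacc, watchStep]
    · cases A.run ((List.range i).map τ) with
      | none => simp [hacc, watchStep]
      | some q => cases hq : A.accept q <;> simp [hacc, watchStep, hq]

theorem exists_watch_eq_none_iff (h0 : w 0 = prodStart A B)
    (hw : ∀ i, prodStep A B (w i) (τ i) = w (i + 1)) :
    (∃ i, (w i).1 = none) ↔ ∃ i, (List.range i).map τ ∈ A.toNFA.accepts := by
  simp only [watch_eq_ite h0 hw, ite_eq_left_iff, reduceCtorEq, imp_false, not_not]
  exact ⟨fun ⟨_, j, _, hj⟩ => ⟨j, hj⟩, fun ⟨j, hj⟩ => ⟨j + 1, j, j.lt_succ_self, hj⟩⟩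

theorem counterexample_iff_exists_forall_prodRel :
    Counterexample A.toNFA.accepts B.toNFA.accepts ↔
      ∃ w : ℕ → ProdState k k' n n', w 0 = prodStart A B ∧
        (∀ i, ProdRel A B (w i) (w (i + 1))) ∧ ∃ i, (w i).1 = none := by
  simp only [Counterexample, exists_isPrefix_iff, not_exists]
  constructor
  · rintro ⟨τ, hA, hB⟩
    let w (i : ℕ) : ProdState k k' n n' :=
      Nat.rec (prodStart A B) (fun i x => prodStep A B x (τ i)) i
    have hw (i : ℕ) : prodStep A B (w i) (τ i) = w (i + 1) := rfl
    refine ⟨w, rfl, fun i => ⟨fun hbad => ?_, τ i, hw i⟩, (exists_watch_eq_none_iff rfl hw).2 hA⟩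
    obtain ⟨f, hf⟩ := (prodBad_iff_exists_mem_accepts rfl hw i).1 hbad
    exact hB f i hf
  · rintro ⟨w, h0, hw, hacc⟩
    choose hbad τ hτ using hw
    exact ⟨τ, (exists_watch_eq_none_iff h0 hτ).1 hacc,
      fun f i hf => hbad i ((prodBad_iff_exists_mem_accepts h0 hτ i).2 ⟨f, hf⟩)⟩

/-- The number of states of the product. -/
abbrev prodSize (k k' n n' : ℕ) : ℕ := (n + 2) * (n' + 1) ^ k ^ k'

theorem card_prodState : Fintype.card (ProdState k k' n n') = prodSize k k' n n' := by
  simp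

theorem counterexample_iff_exists_walk {l : ℕ} (hl : prodSize k k' n n' ≤ l) :
    Counterexample A.toNFA.accepts B.toNFA.accepts ↔
      ∃ y z, Walk (ProdRel A B) l (prodStart A B) y ∧ y.1 = none ∧ Walk (ProdRel A B) l y z := by
  rw [counterexample_iff_exists_forall_prodRel]
  refine exists_forall_rel_and_exists_iff (Acc := fun x => x.1 = none) ?_
    (card_prodState.trans_le hl)
  rintro x _ ⟨-, v, rfl⟩ hx
  simp only [prodStep, hx, watchStep]

end Product

section Numbering

variable {s k k' n n' : ℕ}

/-- The number `q` of a state `some q`, and the number `n` for the absent state `none`, as in the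
transition table of `encodeAut`. -/
def stateCode : Option (Fin n) ≃ Fin (n + 1) := finSuccEquivLast.symm

@[simp]
theorem val_stateCode_none : (stateCode (none : Option (Fin n)) : ℕ) = n := by
  simp [stateCode]

@[simp]
theorem val_stateCode_some (q : Fin n) : (stateCode (some q) : ℕ) = q := by
  simp [stateCode]

/-- The number of a first component of a product state: `n + 1` after acceptance, and otherwise the
number of the state of the watched automaton. -/
def watchCode : Option (Option (Fin n)) ≃ Fin (n + 2) :=
  (Equiv.optionCongr stateCode).trans finSuccEquivLast.symm

@[simp]
theorem val_watchCode_none : (watchCode (none : Option (Option (Fin n))) : ℕ) = n + 1 := by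
  simp [watchCode]

@[simp]
theorem val_watchCode_some (o : Option (Fin n)) : (watchCode (some o) : ℕ) = stateCode o := by
  simp [watchCode]

/-- A product state as a number, whose digits in base `n' + 1` are the numbers of the states of the
copies, followed by the number of the first component as the leading digit. -/
def prodCode : ProdState k k' n n' ≃ Fin (prodSize k k' n n') :=
  (watchCode.prodCongr
    ((finFunctionFinEquiv.arrowCongr stateCode).trans finFunctionFinEquiv)).trans finProdFinEquiv

/-- The digits of `prodCode x`: the numbers of the states of the `k ^ k'` copies, and at the
position `k ^ k'` the number of the first component. -/
def digit (x : ProdState k k' n n') (i : ℕ) : ℕ :=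
  if h : i < k ^ k' then stateCode (x.2 (finFunctionFinEquiv.symm ⟨i, h⟩)) else watchCode x.1

theorem digit_of_lt (x : ProdState k k' n n') {i : ℕ} (hi : i < k ^ k') :
    digit x i = stateCode (x.2 (finFunctionFinEquiv.symm ⟨i, hi⟩)) :=
  dif_pos hi

theorem digit_last (x : ProdState k k' n n') : digit x (k ^ k') = watchCode x.1 :=
  dif_neg (lt_irrefl _)

theorem digit_lt (x : ProdState k k' n n') (i : ℕ) : digit x i < n + n' + 2 := by
  unfold digit
  split
  · exact (Fin.is_lt _).trans_le (by omega)
  · exact (Fin.is_lt _).trans_le (by omega)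

theorem val_prodCode_eq_add (x : ProdState k k' n n') :
    (prodCode x : ℕ) = finFunctionFinEquiv (fun i => stateCode (x.2 (finFunctionFinEquiv.symm i))) +
      (n' + 1) ^ k ^ k' * digit x (k ^ k') := by
  rw [digit_last]
  rfl

theorem val_prodCode_eq_sum (x : ProdState k k' n n') :
    (prodCode x : ℕ) = ∑ i ∈ Finset.range (k ^ k'), digit x i * (n' + 1) ^ i +
      digit x (k ^ k') * (n' + 1) ^ k ^ k' := by
  rw [val_prodCode_eq_add, Finset.sum_range, finFunctionFinEquiv_apply,
    mul_comm (digit x (k ^ k'))]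
  simp only [digit_of_lt x (Fin.is_lt _), Fin.eta]

theorem prodCode_div_mod_eq_digit (x : ProdState k k' n n') {i : ℕ} (hi : i < k ^ k') :
    prodCode x / (n' + 1) ^ i % (n' + 1) = digit x i := by
  obtain ⟨j, hj⟩ := Nat.exists_eq_add_of_lt hi
  have hpow : (n' + 1) ^ k ^ k' * digit x (k ^ k') =
      (n' + 1) ^ i * ((n' + 1) * ((n' + 1) ^ j * digit x (k ^ k'))) := by
    nth_rw 1 [hj]
    ring
  rw [val_prodCode_eq_add, hpow, Nat.add_mul_div_left _ _ (by positivity),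
    Nat.add_mul_mod_self_left, digit_of_lt x hi]
  exact congrArg Fin.val (congrFun (finFunctionFinEquiv.symm_apply_apply
    fun i => stateCode (x.2 (finFunctionFinEquiv.symm i))) ⟨i, hi⟩)

theorem prodCode_div_eq_digit (x : ProdState k k' n n') :
    prodCode x / (n' + 1) ^ k ^ k' = digit x (k ^ k') := by
  rw [val_prodCode_eq_add, Nat.add_mul_div_left _ _ (by positivity),
    Nat.div_eq_of_lt (Fin.is_lt _), zero_add]

theorem fst_eq_none_iff (x : ProdState k k' n n') : x.1 = none ↔ digit x (k ^ k') - n ≠ 0 := by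
  rw [digit_last]
  rcases x.1 with _ | o
  · simp
  · simp [Nat.sub_eq_zero_of_le (Nat.lt_succ_iff.1 (stateCode o).isLt)]

/-- The list `inp` contains at position `b` the representation `encodeAut A`. -/
structure Encodes (inp : List ℕ) (b : ℕ) (A : DetAut (Fin k → Fin s) n) : Prop where
  size : inp.getD b 0 = n
  start : inp.getD (b + 1) 0 = A.start
  accept : ∀ q : Fin n, inp.getD (b + 2 + q) 0 = if A.accept q then 1 else 0
  step : ∀ (q : Fin n) (v : Fin k → Fin s),
    inp.getD (b + 2 + n + q * s ^ k + finFunctionFinEquiv v) 0 = stateCode (A.step q v)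

theorem length_encodeAut (A : DetAut (Fin k → Fin s) n) :
    (encodeAut A).length = n + n * s ^ k + 2 := by
  simp [encodeAut]

theorem encodeAut_getD_accept (A : DetAut (Fin k → Fin s) n) (q : Fin n) :
    (encodeAut A).getD (2 + q) 0 = if A.accept q then 1 else 0 := by
  rw [add_comm, encodeAut, List.getD_cons_succ, List.getD_cons_succ,
    List.getD_append _ _ _ _ (by simp)]
  simp [List.getD_eq_getElem?_getD]

theorem encodeAut_getD_step (A : DetAut (Fin k → Fin s) n) (q : Fin n) (v : Fin k → Fin s) :
    (encodeAut A).getD (2 + n + (finFunctionFinEquiv v + s ^ k * q)) 0 =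
      stateCode (A.step q v) := by
  have hlt : (finFunctionFinEquiv v + s ^ k * q : ℕ) < n * s ^ k :=
    (finProdFinEquiv (q, finFunctionFinEquiv v)).isLt
  have heq : (⟨finFunctionFinEquiv v + s ^ k * q, hlt⟩ : Fin (n * s ^ k)) =
    finProdFinEquiv (q, finFunctionFinEquiv v) := rfl
  rw [add_assoc, add_comm, encodeAut, List.getD_cons_succ, List.getD_cons_succ,
    List.getD_append_right _ _ _ _ (by simp)]
  simp only [List.length_ofFn, Nat.add_sub_cancel_left, List.getD_eq_getElem?_getD,
    List.getElem?_ofFn, hlt, dif_pos, heq, Equiv.symm_apply_apply, Option.getD_some]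
  cases A.step q v <;> simp

theorem encodes_append (A : DetAut (Fin k → Fin s) n) (l l' : List ℕ) :
    Encodes (l ++ (encodeAut A ++ l')) l.length A := by
  have getD_add {i : ℕ} (hi : i < n + n * s ^ k + 2) :
      (l ++ (encodeAut A ++ l')).getD (l.length + i) 0 = (encodeAut A).getD i 0 := by
    rw [List.getD_append_right _ _ _ _ (Nat.le_add_right _ _), Nat.add_sub_cancel_left,
      List.getD_append _ _ _ _ (hi.trans_eq (length_encodeAut A).symm)]
  refine ⟨getD_add (i := 0) (by omega), getD_add (i := 1) (by omega), fun q => ?_, fun q v => ?_⟩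
  · rw [add_assoc, getD_add (by omega), encodeAut_getD_accept]
  · have hlt : (finFunctionFinEquiv v + s ^ k * q : ℕ) < n * s ^ k :=
      (finProdFinEquiv (q, finFunctionFinEquiv v)).isLt
    rw [← encodeAut_getD_step, ← getD_add (by omega)]
    congr 1
    ring

/-- The number of the letter that results from the `i`-th choice of `k'` components of the letter
with the number `v`. -/
def letter (s k k' i v : ℕ) : ℕ :=
  ∑ j ∈ Finset.range k', v / s ^ (i / k ^ j % k) % s * s ^ j

theorem letter_eq (i : Fin (k ^ k')) (v : Fin k → Fin s) :
    letter s k k' i (finFunctionFinEquiv v) =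
      finFunctionFinEquiv (v ∘ finFunctionFinEquiv.symm i) := by
  have component (a : Fin k) : (finFunctionFinEquiv v : ℕ) / s ^ (a : ℕ) % s = v a := by
    conv_rhs => rw [← Equiv.symm_apply_apply finFunctionFinEquiv v]
    rfl
  rw [finFunctionFinEquiv_apply, letter, Finset.sum_range]
  exact Finset.sum_congr rfl fun j _ =>
    congrArg (· * s ^ (j : ℕ)) (component (finFunctionFinEquiv.symm i j))

variable {inp : List ℕ} {a b : ℕ} {A : DetAut (Fin k → Fin s) n} {B : DetAut (Fin k' → Fin s) n'}

theorem prodBad_iff_exists_digit (hB : Encodes inp b B) (x : ProdState k k' n n') :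
    ProdBad B x ↔ ∃ i < k ^ k', digit x i < n' ∧ inp.getD (b + 2 + digit x i) 0 ≠ 0 := by
  have copy_accepts (o : Option (Fin n')) : (∃ q, o = some q ∧ B.accept q = true) ↔
      stateCode o < n' ∧ inp.getD (b + 2 + stateCode o) 0 ≠ 0 := by
    cases o with
    | none => simp
    | some q => simp [hB.accept, -List.getD_eq_getElem?_getD]
  simp only [ProdBad, copy_accepts]
  constructor
  · rintro ⟨f, hf⟩
    refine ⟨finFunctionFinEquiv f, (finFunctionFinEquiv f).isLt, ?_⟩
    rwa [digit_of_lt x (finFunctionFinEquiv f).isLt, Fin.eta, Equiv.symm_apply_apply]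
  · rintro ⟨i, hi, h⟩
    exact ⟨finFunctionFinEquiv.symm ⟨i, hi⟩, by rwa [← digit_of_lt]⟩

theorem digit_prodStep_of_lt (hB : Encodes inp b B) (x : ProdState k k' n n') (v : Fin k → Fin s)
    {i : ℕ} (hi : i < k ^ k') :
    digit (prodStep A B x v) i = if digit x i < n' then
      inp.getD (b + 2 + n' + digit x i * s ^ k' + letter s k k' i (finFunctionFinEquiv v)) 0
      else digit x i := by
  simp only [digit_of_lt _ hi, prodStep]
  cases x.2 (finFunctionFinEquiv.symm ⟨i, hi⟩) with
  | none => simp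
  | some q =>
    simp only [letter_eq ⟨i, hi⟩ v, val_stateCode_some, q.isLt, if_true, hB.step, Option.bind_some]

theorem digit_prodStep_last (hA : Encodes inp a A) (x : ProdState k k' n n') (v : Fin k → Fin s) :
    digit (prodStep A B x v) (k ^ k') = if digit x (k ^ k') < n then
      if inp.getD (a + 2 + digit x (k ^ k')) 0 ≠ 0 then n + 1
      else inp.getD (a + 2 + n + digit x (k ^ k') * s ^ k + finFunctionFinEquiv v) 0
      else digit x (k ^ k') := by
  simp only [digit_last, prodStep]
  rcases x.1 with _ | _ | q
  · simp [watchStep]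
  · simp [watchStep]
  · cases hq : A.accept q <;> simp only [watchStep, hq, hA.accept, hA.step, val_watchCode_some,
      val_stateCode_some, val_watchCode_none, q.isLt, if_true, if_false, reduceCtorEq, ne_eq,
      not_true_eq_false, one_ne_zero, not_false_eq_true]

theorem digit_prodStart_of_lt (hB : Encodes inp b B) {i : ℕ} (hi : i < k ^ k') :
    digit (prodStart A B) i = inp.getD (b + 1) 0 := by
  rw [digit_of_lt _ hi, hB.start, prodStart, val_stateCode_some]

theorem digit_prodStart_last (hA : Encodes inp a A) :
    digit (prodStart A B) (k ^ k') = inp.getD (a + 1) 0 := by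
  rw [digit_last, hA.start, prodStart, val_watchCode_some, val_stateCode_some]

end Numbering

/-! ### Executions of machine programs -/

section Total

/-- `Total inp ok dem t c Q`: started in `c`, the machine halts within `t` steps in a memory
satisfying `Q`, and passes only through memories satisfying `ok`. This refers to all runs if
`dem` is true (the choices are demonic), and to some run if `dem` is false. -/
def Total (inp : List ℕ) (ok : Mem → Prop) (dem : Bool) : ℕ → Config → (Mem → Prop) → Prop
  | 0, c, Q => ok c.2 ∧ c.1 = [] ∧ Q c.2
  | t + 1, c, Q => ok c.2 ∧ ((c.1 = [] ∧ Q c.2) ∨ (c.1 ≠ [] ∧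
      bif dem then ∀ c' ∈ c.next inp, Total inp ok dem t c' Q
      else ∃ c' ∈ c.next inp, Total inp ok dem t c' Q))

variable {inp : List ℕ} {ok : Mem → Prop} {dem : Bool} {t t' : ℕ} {M M' : Mem}
  {p q : Prog} {Q Q' : Mem → Prop}

theorem Total.mono {c : Config} (h : Total inp ok dem t c Q) (ht : t ≤ t')
    (hQ : ∀ M, Q M → Q' M) : Total inp ok dem t' c Q' := by
  induction t generalizing t' c with
  | zero =>
    obtain ⟨hok, hc, hM⟩ := h
    cases t' with
    | zero => exact ⟨hok, hc, hQ _ hM⟩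
    | succ t' => exact ⟨hok, Or.inl ⟨hc, hQ _ hM⟩⟩
  | succ t ih =>
    obtain ⟨t', rfl⟩ : ∃ u, t' = u + 1 := ⟨t' - 1, by omega⟩
    obtain ⟨hok, ⟨hc, hM⟩ | ⟨hc, hnext⟩⟩ := h
    · exact ⟨hok, Or.inl ⟨hc, hQ _ hM⟩⟩
    · refine ⟨hok, Or.inr ⟨hc, ?_⟩⟩
      cases dem with
      | true => exact fun c' hc' => ih (hnext c' hc') (by omega)
      | false =>
        obtain ⟨c', hc', h'⟩ := hnext
        exact ⟨c', hc', ih h' (by omega)⟩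

theorem Total.imp {c : Config} (h : Total inp ok dem t c Q) (hQ : ∀ M, Q M → Q' M) :
    Total inp ok dem t c Q' :=
  h.mono le_rfl hQ

theorem Total.weaken {c : Config} (h : Total inp ok dem t c Q) (ht : t ≤ t') :
    Total inp ok dem t' c Q :=
  h.mono ht fun _ => id

theorem Total.ok_mem {c : Config} (h : Total inp ok dem t c Q) : ok c.2 := by
  cases t <;> exact h.1

theorem total_nil (hM : ok M) (hQ : Q M) : Total inp ok dem t ([], M) Q := by
  cases t with
  | zero => exact ⟨hM, rfl, hQ⟩
  | succ t => exact ⟨hM, Or.inl ⟨rfl, hQ⟩⟩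

theorem Total.post (h : Total inp ok dem t ([], M) Q) : Q M := by
  cases t with
  | zero => exact h.2.2
  | succ t =>
    obtain ⟨-, ⟨-, h⟩ | ⟨h, -⟩⟩ := h
    · exact h
    · exact absurd rfl h

theorem mem_next_append {K K' : List Prog} (hK : K ≠ []) (c : Config) :
    c ∈ Config.next inp (K ++ K', M) ↔
      ∃ c₀ ∈ Config.next inp (K, M), c = (c₀.1 ++ K', c₀.2) := by
  obtain ⟨p, K, rfl⟩ := List.exists_cons_of_ne_nil hK
  cases p with
  | instr a =>
    simp only [List.cons_append, Config.next, Set.mem_ofPred_eq]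
    constructor
    · rintro ⟨M', h, rfl⟩
      exact ⟨_, ⟨M', h, rfl⟩, rfl⟩
    · rintro ⟨_, ⟨M', h, rfl⟩, rfl⟩
      exact ⟨M', h, rfl⟩
  | seq p q => simp [Config.next]
  | ite i p q => by_cases h : M i = 0 <;> simp [Config.next, h]
  | loop i p => by_cases h : M i = 0 <;> simp [Config.next, h]

theorem Total.append {K K' : List Prog}
    (h : Total inp ok dem t (K, M) fun M' => Total inp ok dem t' (K', M') Q) :
    Total inp ok dem (t + t') (K ++ K', M) Q := by
  induction t generalizing K M with
  | zero =>
    obtain ⟨-, hK, h'⟩ := h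
    obtain rfl : K = [] := hK
    simpa using h'
  | succ t ih =>
    obtain ⟨hok, ⟨hK, h'⟩ | ⟨hK, hnext⟩⟩ := h
    · obtain rfl : K = [] := hK
      exact Total.weaken h' (by omega)
    · have hK : K ≠ [] := hK
      rw [Nat.succ_add]
      refine ⟨hok, Or.inr ⟨by simp [hK], ?_⟩⟩
      cases dem with
      | true =>
        intro c' hc'
        obtain ⟨c₀, hc₀, rfl⟩ := (mem_next_append hK c').1 hc'
        exact ih (hnext c₀ hc₀)
      | false =>
        obtain ⟨c₀, hc₀, h'⟩ := hnext
        exact ⟨_, (mem_next_append hK _).2 ⟨c₀, hc₀, rfl⟩, ih h'⟩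

theorem Total.of_next_eq {c c' : Config} (hok : ok c.2) (hc : c.1 ≠ [])
    (hn : c.next inp = {c'}) (h : Total inp ok dem t c' Q) : Total inp ok dem (t + 1) c Q := by
  refine ⟨hok, Or.inr ⟨hc, ?_⟩⟩
  cases dem <;> simpa [hn] using h

theorem Total.seq (hM : ok M)
    (h : Total inp ok dem t ([p], M) fun M' => Total inp ok dem t' ([q], M') Q) :
    Total inp ok dem (t + t' + 1) ([.seq p q], M) Q :=
  Total.of_next_eq hM (by simp) rfl h.append

theorem total_instr {a : Instr} (hM : ok M) (ha : a.exec inp M = {M'}) (hM' : ok M')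
    (hQ : Q M') : Total inp ok dem 1 ([.instr a], M) Q :=
  Total.of_next_eq (c' := ([], M')) hM (by simp) (by simp [Config.next, ha]) (total_nil hM' hQ)

theorem Total.instr_seq {a : Instr} (hM : ok M) (ha : a.exec inp M = {M'})
    (h : Total inp ok dem t ([q], M') Q) :
    Total inp ok dem (t + 2) ([.seq (.instr a) q], M) Q :=
  (Total.seq hM (total_instr hM ha h.ok_mem h)).weaken (by omega)

theorem Total.ite {i : ℕ} (hM : ok M) (hp : M i ≠ 0 → Total inp ok dem t ([p], M) Q)
    (hq : M i = 0 → Total inp ok dem t ([q], M) Q) :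
    Total inp ok dem (t + 1) ([.ite i p q], M) Q := by
  by_cases hi : M i = 0
  · exact Total.of_next_eq hM (by simp) (by simp [Config.next, hi]) (hq hi)
  · exact Total.of_next_eq hM (by simp) (by simp [Config.next, hi]) (hp hi)

theorem total_loop_of_eq_zero {i : ℕ} (hM : ok M) (hi : M i = 0) (hQ : Q M) :
    Total inp ok dem 1 ([.loop i p], M) Q :=
  Total.of_next_eq (c' := ([], M)) hM (by simp) (by simp [Config.next, hi]) (total_nil hM hQ)

theorem Total.loop_of_ne_zero {i : ℕ} (hM : ok M) (hi : M i ≠ 0)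
    (h : Total inp ok dem t ([p], M) fun M' => Total inp ok dem t' ([.loop i p], M') Q) :
    Total inp ok dem (t + t' + 1) ([.loop i p], M) Q :=
  Total.of_next_eq hM (by simp) (by simp [Config.next, hi]) h.append

theorem Total.of_run {P : Prog} {T : ℕ} (h : Total inp ok true T ([P], fun _ => 0) Q)
    {c : Config} (hr : Run P inp t c) : t ≤ T ∧ Total inp ok true (T - t) c Q := by
  induction hr with
  | init => exact ⟨by omega, h⟩
  | @step t c c' _ hc ih =>
    obtain ⟨ht, h⟩ := ih
    have hne : c.1 ≠ [] := by
      rcases c with ⟨_ | ⟨p, K⟩, M⟩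
      · exact absurd hc (by simp [Config.next])
      · simp
    obtain ⟨d, hd⟩ : ∃ d, T - t = d := ⟨_, rfl⟩
    rw [hd] at h
    cases d with
    | zero => exact absurd h.2.1 hne
    | succ d =>
      obtain ⟨-, ⟨hnil, -⟩ | ⟨-, hnext⟩⟩ := h
      · exact absurd hnil hne
      · refine ⟨by omega, ?_⟩
        rw [show T - (t + 1) = d by omega]
        exact hnext c' hc

theorem Total.exists_run {P : Prog} {T : ℕ} (h : Total inp ok false T ([P], fun _ => 0) Q) :
    ∃ t M, Run P inp t ([], M) ∧ Q M := by
  suffices ∀ T t c, Run P inp t c → Total inp ok false T c Q →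
      ∃ t M, Run P inp t ([], M) ∧ Q M from this T 0 _ .init h
  intro T
  induction T with
  | zero =>
    rintro t ⟨K, M⟩ hr ⟨-, rfl, hQ⟩
    exact ⟨t, M, hr, hQ⟩
  | succ T ih =>
    rintro t ⟨K, M⟩ hr ⟨-, ⟨rfl, hQ⟩ | ⟨-, c', hc', h⟩⟩
    · exact ⟨t, M, hr, hQ⟩
    · exact ih _ _ (.step hr hc') h

end Total

/-! ### A structured language with registers and a heap -/

section Language

/-- The arithmetic operations of the machine. -/
inductive Op where
  | add | sub | mul | div | mod

/-- The value of an arithmetic operation. -/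
def Op.eval : Op → ℕ → ℕ → ℕ
  | .add, a, b => a + b
  | .sub, a, b => a - b
  | .mul, a, b => a * b
  | .div, a, b => a / b
  | .mod, a, b => a % b

/-- The machine instruction of an arithmetic operation. -/
def Op.instr : Op → ℕ → ℕ → ℕ → Instr
  | .add => .add
  | .sub => .sub
  | .mul => .mul
  | .div => .div
  | .mod => .mod

/-- Expressions over registers from `ρ`. The expression `fold o c x n e` combines the values of
`e` for `x = 0, …, n - 1` by `o`, starting from `c`; the variable `x` is bound. -/
inductive Expr (ρ : Type) where
  | const (c : ℕ)
  | var (x : ρ)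
  | bin (o : Op) (a b : Expr ρ)
  | heap (a : Expr ρ)
  | input (a : Expr ρ)
  | ite (c a b : Expr ρ)
  | fold (o : Op) (c : ℕ) (x : ρ) (n e : Expr ρ)

/-- Statements over registers from `ρ`. -/
inductive Stm (ρ : Type) where
  | assign (x : ρ) (e : Expr ρ)
  | store (a e : Expr ρ)
  | guess (x : ρ) (e : Expr ρ)
  | seq (p q : Stm ρ)
  | ite (e : Expr ρ) (p q : Stm ρ)
  | loop (e : Expr ρ) (p : Stm ρ)

/-- The statement contains no `guess`. -/
def Stm.NoGuess {ρ : Type} : Stm ρ → Prop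
  | .assign _ _ => True
  | .store _ _ => True
  | .guess _ _ => False
  | .seq p q => p.NoGuess ∧ q.NoGuess
  | .ite _ p q => p.NoGuess ∧ q.NoGuess
  | .loop _ p => p.NoGuess

/-- The contents of the registers and of the heap. -/
structure Store (ρ : Type) where
  r : ρ → ℕ
  h : ℕ → ℕ

/-- The parameters of an execution: the input, a bound `Z` for the values of all registers and
heap cells, a bound `H` for the size of the heap, a bound `T` for the number of rounds of each
loop, and whether the choices are demonic, as in `Total`. -/
structure Env where
  inp : List ℕ
  Z : ℕ
  H : ℕ
  T : ℕ
  dem : Bool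

/-- The value of a `fold` over the values `f 0, f 1, …`. -/
def foldValue (o : Op) (c : ℕ) (f : ℕ → ℕ) : ℕ → ℕ
  | 0 => c
  | n + 1 => o.eval (foldValue o c f n) (f n)

theorem foldValue_add (f : ℕ → ℕ) (n : ℕ) :
    foldValue .add 0 f n = ∑ i ∈ Finset.range n, f i := by
  induction n with
  | zero => rfl
  | succ n ih => rw [Finset.sum_range_succ, ← ih]; rfl

theorem foldValue_mul (m n : ℕ) : foldValue .mul 1 (fun _ => m) n = m ^ n := by
  induction n with
  | zero => rfl
  | succ n ih => rw [pow_succ, ← ih]; rfl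

variable {ρ : Type} [DecidableEq ρ]

/-- Assignment to a register. -/
def Store.set (σ : Store ρ) (x : ρ) (v : ℕ) : Store ρ := ⟨Function.update σ.r x v, σ.h⟩

/-- Assignment to a heap cell. -/
def Store.put (σ : Store ρ) (a v : ℕ) : Store ρ := ⟨σ.r, Function.update σ.h a v⟩

theorem Store.set_set (σ : Store ρ) (x : ρ) (v w : ℕ) : (σ.set x v).set x w = σ.set x w := by
  simp [Store.set]

theorem Store.set_eq_self (σ : Store ρ) (x : ρ) : σ.set x (σ.r x) = σ := by
  simp [Store.set]

/-- `Yields E σ e m`: in the store `σ` the expression `e` has the value `m`, and neither a bound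
variable nor an intermediate value of a `fold` exceeds `E.Z` in its evaluation. -/
inductive Yields (E : Env) : Store ρ → Expr ρ → ℕ → Prop where
  | const {σ : Store ρ} (c : ℕ) : Yields E σ (.const c) c
  | var {σ : Store ρ} (x : ρ) : Yields E σ (.var x) (σ.r x)
  | bin {σ : Store ρ} {a b : Expr ρ} {m n : ℕ} (o : Op) (ha : Yields E σ a m)
      (hb : Yields E σ b n) : Yields E σ (.bin o a b) (o.eval m n)
  | heap {σ : Store ρ} {a : Expr ρ} {m : ℕ} (ha : Yields E σ a m) : Yields E σ (.heap a) (σ.h m)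
  | input {σ : Store ρ} {a : Expr ρ} {m : ℕ} (ha : Yields E σ a m) :
      Yields E σ (.input a) (E.inp.getD m 0)
  | ite_true {σ : Store ρ} {c a b : Expr ρ} {l m : ℕ} (hc : Yields E σ c l) (hl : l ≠ 0)
      (ha : Yields E σ a m) : Yields E σ (.ite c a b) m
  | ite_false {σ : Store ρ} {c a b : Expr ρ} {m : ℕ} (hc : Yields E σ c 0)
      (hb : Yields E σ b m) : Yields E σ (.ite c a b) m
  | fold {σ : Store ρ} {x : ρ} {n e : Expr ρ} {N : ℕ} (o : Op) (c : ℕ) (f : ℕ → ℕ)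
      (hn : Yields E σ n N) (hN : N ≤ E.Z) (he : ∀ i < N, Yields E (σ.set x i) e (f i))
      (hf : ∀ i ≤ N, foldValue o c f i ≤ E.Z) : Yields E σ (.fold o c x n e) (foldValue o c f N)

/-- Weakest preconditions of a loop with at most `n` rounds. -/
def wpLoop (E : Env) (e : Expr ρ) (body : Store ρ → (Store ρ → Prop) → Prop) :
    ℕ → Store ρ → (Store ρ → Prop) → Prop
  | 0, σ, Q => Yields E σ e 0 ∧ Q σ
  | n + 1, σ, Q => ∃ m, Yields E σ e m ∧ (m = 0 → Q σ) ∧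
      (m ≠ 0 → body σ fun σ' => wpLoop E e body n σ' Q)

/-- Weakest preconditions, including the bounds on values, addresses and rounds of loops. -/
def wp (E : Env) : Stm ρ → Store ρ → (Store ρ → Prop) → Prop
  | .assign x e, σ, Q => ∃ m, Yields E σ e m ∧ m ≤ E.Z ∧ Q (σ.set x m)
  | .store a e, σ, Q => ∃ l m, Yields E σ a l ∧ Yields E σ e m ∧ l < E.H ∧ m ≤ E.Z ∧ Q (σ.put l m)
  | .guess x e, σ, Q => ∃ m, Yields E σ e m ∧ m ≤ E.Z ∧
      bif E.dem then ∀ v ≤ m, Q (σ.set x v) else ∃ v ≤ m, Q (σ.set x v)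
  | .seq p q, σ, Q => wp E p σ fun σ' => wp E q σ' Q
  | .ite e p q, σ, Q => ∃ m, Yields E σ e m ∧ (m ≠ 0 → wp E p σ Q) ∧ (m = 0 → wp E q σ Q)
  | .loop e p, σ, Q => wpLoop E e (wp E p) E.T σ Q

variable {E : Env} {σ : Store ρ} {Q Q' : Store ρ → Prop}

theorem wpLoop_mono {e : Expr ρ} {body : Store ρ → (Store ρ → Prop) → Prop}
    (hb : ∀ σ Q Q', body σ Q → (∀ σ', Q σ' → Q' σ') → body σ Q') {n : ℕ}
    (h : wpLoop E e body n σ Q) (hQ : ∀ σ', Q σ' → Q' σ') : wpLoop E e body n σ Q' := by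
  induction n generalizing σ with
  | zero => exact ⟨h.1, hQ _ h.2⟩
  | succ n ih =>
    obtain ⟨m, hm, hexit, hround⟩ := h
    exact ⟨m, hm, fun h => hQ _ (hexit h), fun h => hb _ _ _ (hround h) fun _ => ih⟩

theorem wp_mono {p : Stm ρ} (h : wp E p σ Q) (hQ : ∀ σ', Q σ' → Q' σ') : wp E p σ Q' := by
  induction p generalizing σ Q Q' with
  | assign x e =>
    obtain ⟨m, hm, hle, h⟩ := h
    exact ⟨m, hm, hle, hQ _ h⟩
  | store a e =>
    obtain ⟨l, m, hl, hm, hlt, hle, h⟩ := h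
    exact ⟨l, m, hl, hm, hlt, hle, hQ _ h⟩
  | guess x e =>
    obtain ⟨m, hm, hle, h⟩ := h
    refine ⟨m, hm, hle, ?_⟩
    cases hd : E.dem with
    | true =>
      rw [hd] at h
      exact fun v hv => hQ _ (h v hv)
    | false =>
      rw [hd] at h
      obtain ⟨v, hv, h⟩ := h
      exact ⟨v, hv, hQ _ h⟩
  | seq p q ihp ihq => exact ihp h fun σ' h' => ihq h' hQ
  | ite e p q ihp ihq =>
    obtain ⟨m, hm, hp, hq⟩ := h
    exact ⟨m, hm, fun h => ihp (hp h) hQ, fun h => ihq (hq h) hQ⟩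
  | loop e p ih => exact wpLoop_mono (body := wp E p) (fun _ _ _ h h' => ih h h') h hQ

theorem wp_loop_count {e : Expr ρ} {p : Stm ρ} (n : ℕ) (I : ℕ → Store ρ → Prop)
    (hn : n ≤ E.T) (h0 : I 0 σ)
    (hs : ∀ i σ, i < n → I i σ → (∃ m ≠ 0, Yields E σ e m) ∧ wp E p σ (I (i + 1)))
    (hQ : ∀ σ, I n σ → Yields E σ e 0 ∧ Q σ) : wp E (.loop e p) σ Q := by
  suffices ∀ m i σ, n ≤ i + m → i ≤ n → I i σ → wpLoop E e (wp E p) m σ Q from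
    this E.T 0 σ (by omega) (by omega) h0
  intro m
  induction m with
  | zero =>
    intro i σ hm hi hI
    obtain rfl : i = n := by omega
    exact hQ σ hI
  | succ m ih =>
    intro i σ hm hi hI
    rcases hi.lt_or_eq with hi | rfl
    · obtain ⟨⟨l, hl, he⟩, hp⟩ := hs i σ hi hI
      exact ⟨l, he, fun h => absurd h hl,
        fun _ => wp_mono hp fun σ' hI' => ih (i + 1) σ' (by omega) hi hI'⟩
    · exact ⟨0, (hQ σ hI).1, fun _ => (hQ σ hI).2, fun h => absurd rfl h⟩

end Language

/-! ### Compilation to machine programs -/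

section Compilation

variable {ρ : Type}

/-- A bound for the number of temporary cells, and for the growth of the values. -/
def Expr.size : Expr ρ → ℕ
  | .const c => c + 1
  | .var _ => 1
  | .bin _ a b => a.size + b.size
  | .heap a => a.size + 1
  | .input a => a.size + 1
  | .ite c a b => c.size + a.size + b.size
  | .fold _ _ _ n e => n.size + e.size + 3

/-- A bound for the size of all expressions. -/
def Stm.size : Stm ρ → ℕ
  | .assign _ e => e.size + 2
  | .store a e => a.size + e.size + 2
  | .guess _ e => e.size
  | .seq p q => p.size + q.size
  | .ite e p q => e.size + p.size + q.size
  | .loop e p => e.size + p.size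

/-- A bound for the number of steps of the compiled expression, a polynomial in a bound for the
bound variables. -/
noncomputable def Expr.time : Expr ρ → Polynomial ℕ
  | .const _ => 1
  | .var _ => 3
  | .bin _ a b => a.time + (b.time + 1 + 1) + 1
  | .heap a => a.time + 5 + 1
  | .input a => a.time + 1 + 1
  | .ite c a b => c.time + (a.time + b.time + 1) + 1
  | .fold _ _ _ n e => n.time + (.X * (e.time + 9) + 13) + 1

/-- A bound for the number of steps of the compiled statement, a polynomial in a bound for the
bound variables and the number of rounds of each loop. -/
noncomputable def Stm.time : Stm ρ → Polynomial ℕ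
  | .assign _ e => e.time + 3 + 1
  | .store a e => a.time + (e.time + 5 + 1) + 1
  | .guess _ e => e.time + 1 + 1
  | .seq p q => p.time + q.time + 1
  | .ite e p q => e.time + (p.time + q.time + 1) + 1
  | .loop e p => e.time + (.X * (p.time + e.time + 2) + 1) + 1

theorem Expr.size_pos (e : Expr ρ) : 0 < e.size := by
  induction e <;> (simp only [Expr.size]; omega)

theorem Op.eval_le_pow (o : Op) {b i j m n : ℕ} (hb : 2 ≤ b) (hi : 0 < i) (hj : 0 < j)
    (hm : m ≤ b ^ i) (hn : n ≤ b ^ j) : o.eval m n ≤ b ^ (i + j) := by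
  have hleft : m ≤ b ^ (i + j) := hm.trans (Nat.pow_le_pow_right (by omega) (by omega))
  have hbi : b ≤ b ^ i := Nat.le_self_pow (by omega) b
  have hbj : b ≤ b ^ j := Nat.le_self_pow (by omega) b
  cases o with
  | add =>
    rw [pow_add]
    change m + n ≤ _
    nlinarith
  | sub => exact (Nat.sub_le _ _).trans hleft
  | mul => exact (Nat.mul_le_mul hm hn).trans_eq (pow_add _ _ _).symm
  | div => exact (Nat.div_le_self _ _).trans hleft
  | mod => exact (Nat.mod_le _ _).trans hleft

theorem Yields.le [DecidableEq ρ] {E : Env} {σ : Store ρ} {e : Expr ρ} {m : ℕ}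
    (h : Yields E σ e m) (hi : ∀ a, E.inp.getD a 0 ≤ E.Z) (hr : ∀ x, σ.r x ≤ E.Z)
    (hh : ∀ a, σ.h a ≤ E.Z) : m ≤ (E.Z + 2) ^ e.size := by
  have le_pow {n m : ℕ} (hn : n ≠ 0) (hm : m ≤ E.Z) : m ≤ (E.Z + 2) ^ n :=
    (hm.trans (Nat.le_add_right _ 2)).trans (Nat.le_self_pow hn _)
  have pow_mono {m i j : ℕ} (hm : m ≤ (E.Z + 2) ^ i) (hij : i ≤ j) : m ≤ (E.Z + 2) ^ j :=
    hm.trans (Nat.pow_le_pow_right (by omega) hij)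
  induction h with
  | const c => exact pow_mono (Nat.lt_pow_self (by omega)).le (Nat.le_succ c)
  | var x => exact le_pow one_ne_zero (hr x)
  | bin o _ _ iha ihb =>
    exact o.eval_le_pow (by omega) (Expr.size_pos _) (Expr.size_pos _) (iha hr hh) (ihb hr hh)
  | heap _ _ => exact le_pow (Nat.succ_ne_zero _) (hh _)
  | input _ _ => exact le_pow (Nat.succ_ne_zero _) (hi _)
  | ite_true _ _ _ _ iha => exact pow_mono (iha hr hh) (by simp only [Expr.size]; omega)
  | ite_false _ _ _ ihb => exact pow_mono (ihb hr hh) (by simp only [Expr.size]; omega)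
  | fold o c f _ _ _ hf _ _ => exact le_pow (by simp [Expr.size]) (hf _ le_rfl)

variable [Fintype ρ] (D : ℕ)

/-- The cell of a register. The memory starts with `D` temporary cells, followed by one cell for
each register and the heap. -/
noncomputable def regCell (x : ρ) : ℕ := D + Fintype.equivFin ρ x

variable (ρ) in
/-- The first heap cell. -/
def heapStart : ℕ := D + Fintype.card ρ

/-- One round of the loop that computes a `fold`, where `p` computes the next value into the cell
`t + 3`. The loop counts down in `t`, accumulates in `t + 1` and counts up in the register. -/
noncomputable def foldRound (o : Op) (x : ρ) (t : ℕ) (p : Prog) : Prog :=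
  .seq p (.seq (.instr (o.instr (t + 1) (t + 1) (t + 3)))
    (.seq (.instr (.const (t + 3) 1)) (.seq (.instr (.sub t t (t + 3)))
    (.instr (.add (regCell D x) (regCell D x) (t + 3))))))

/-- The program that computes an expression into the cell `t`, using no other cells below `D`
than those from `t` on. A `fold` saves its register in `t + 2`. -/
noncomputable def Expr.compile : Expr ρ → ℕ → Prog
  | .const c, t => .instr (.const t c)
  | .var x, t => .seq (.instr (.const t 0)) (.instr (.add t t (regCell D x)))
  | .bin o a b, t =>
      .seq (a.compile t) (.seq (b.compile (t + 1)) (.instr (o.instr t t (t + 1))))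
  | .heap a, t => .seq (a.compile t) (.seq (.instr (.const (t + 1) (heapStart ρ D)))
      (.seq (.instr (.add t t (t + 1))) (.instr (.load t t))))
  | .input a, t => .seq (a.compile t) (.instr (.input t t))
  | .ite c a b, t => .seq (c.compile t) (.ite t (a.compile t) (b.compile t))
  | .fold o c x n e, t => .seq (n.compile t) (.seq (.instr (.const (t + 1) c))
      (.seq (.instr (.const (t + 2) 0)) (.seq (.instr (.add (t + 2) (t + 2) (regCell D x)))
      (.seq (.instr (.const (regCell D x) 0))
      (.seq (.loop t (foldRound D o x t (e.compile (t + 3))))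
      (.seq (.instr (.add (regCell D x) t (t + 2))) (.instr (.add t t (t + 1)))))))))

/-- The program that executes a statement. -/
noncomputable def Stm.compile : Stm ρ → Prog
  | .assign x e => .seq (e.compile D 0)
      (.seq (.instr (.const 1 0)) (.instr (.add (regCell D x) 0 1)))
  | .store a e => .seq (a.compile D 0) (.seq (e.compile D 1)
      (.seq (.instr (.const 2 (heapStart ρ D))) (.seq (.instr (.add 0 0 2))
      (.instr (.store 0 1)))))
  | .guess x e => .seq (e.compile D 0) (.instr (.guess (regCell D x) 0))
  | .seq p q => .seq p.compile q.compile
  | .ite e p q => .seq (e.compile D 0) (.ite 0 p.compile q.compile)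
  | .loop e p => .seq (e.compile D 0) (.loop 0 (.seq p.compile (e.compile D 0)))

theorem Op.deterministic_instr (o : Op) (i j l : ℕ) :
    (Prog.instr (o.instr i j l)).Deterministic := by
  cases o <;> trivial

theorem Expr.deterministic_compile (e : Expr ρ) (t : ℕ) : (e.compile D t).Deterministic := by
  induction e generalizing t <;>
    simp_all [Expr.compile, foldRound, Prog.Deterministic, Op.deterministic_instr]

theorem Stm.deterministic_compile (p : Stm ρ) (h : p.NoGuess) :
    (p.compile D).Deterministic := by
  induction p <;>
    simp_all [Stm.compile, Stm.NoGuess, Prog.Deterministic, Expr.deterministic_compile]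

variable (ρ) in
/-- The largest word that occurs in an execution. -/
def wordBound (Z : ℕ) : ℕ := heapStart ρ D + (Z + 2) ^ D

variable (ρ) in
/-- The memories within the resource bounds. -/
def Fits (E : Env) (M : Mem) : Prop :=
  (∀ a, M a ≤ wordBound ρ D E.Z) ∧ ∀ a, heapStart ρ D + E.H ≤ a → M a = 0

/-- The memory `M` represents the store `σ`. -/
structure Represents (E : Env) (M : Mem) (σ : Store ρ) : Prop where
  fits : Fits ρ D E M
  reg : ∀ x, M (regCell D x) = σ.r x
  heap : ∀ a, M (heapStart ρ D + a) = σ.h a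
  reg_le : ∀ x, σ.r x ≤ E.Z
  heap_le : ∀ a, σ.h a ≤ E.Z

variable {D} {E : Env} {M : Mem} {σ : Store ρ}

theorem le_regCell (x : ρ) : D ≤ regCell D x := Nat.le_add_right _ _

theorem regCell_lt (x : ρ) : regCell D x < heapStart ρ D :=
  Nat.add_lt_add_left (Fintype.equivFin ρ x).isLt D

theorem regCell_injective : Function.Injective (regCell D : ρ → ℕ) := fun _ _ h =>
  (Fintype.equivFin ρ).injective (Fin.ext (Nat.add_left_cancel h))

theorem le_wordBound (hD : D ≠ 0) (Z : ℕ) : Z ≤ wordBound ρ D Z :=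
  (Nat.le_add_right Z 2).trans ((Nat.le_self_pow hD _).trans (Nat.le_add_left _ _))

theorem Fits.update {a v : ℕ} (h : Fits ρ D E M) (ha : a < heapStart ρ D + E.H)
    (hv : v ≤ wordBound ρ D E.Z) : Fits ρ D E (Function.update M a v) := by
  refine ⟨fun b => ?_, fun b hb => ?_⟩
  · rcases eq_or_ne b a with rfl | hb
    · simpa using hv
    · simpa [hb] using h.1 b
  · rw [Function.update_of_ne (by omega)]
    exact h.2 b hb

theorem Represents.update_temp {t v : ℕ} (h : Represents D E M σ) (ht : t < D)
    (hv : v ≤ wordBound ρ D E.Z) : Represents D E (Function.update M t v) σ where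
  fits := h.fits.update (by unfold heapStart; omega) hv
  reg x := by
    rw [Function.update_of_ne (ht.trans_le (le_regCell x)).ne']
    exact h.reg x
  heap a := by
    rw [Function.update_of_ne (by unfold heapStart; omega)]
    exact h.heap a
  reg_le := h.reg_le
  heap_le := h.heap_le

theorem Represents.update_regCell [DecidableEq ρ] {x : ρ} {v : ℕ} (h : Represents D E M σ)
    (hD : D ≠ 0) (hv : v ≤ E.Z) :
    Represents D E (Function.update M (regCell D x) v) (σ.set x v) where
  fits := h.fits.update ((regCell_lt x).trans_le (Nat.le_add_right _ _))
    (hv.trans (le_wordBound hD _))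
  reg y := by
    rcases eq_or_ne y x with rfl | hy
    · simp [Store.set]
    · rw [Function.update_of_ne (regCell_injective.ne hy)]
      simpa [Store.set, hy] using h.reg y
  heap a := by
    rw [Function.update_of_ne ((regCell_lt x).trans_le (Nat.le_add_right _ _)).ne']
    exact h.heap a
  reg_le y := by
    rcases eq_or_ne y x with rfl | hy
    · simpa [Store.set] using hv
    · simpa [Store.set, hy] using h.reg_le y
  heap_le := h.heap_le

theorem Represents.update_heap {a v : ℕ} (h : Represents D E M σ)
    (hD : D ≠ 0) (ha : a < E.H) (hv : v ≤ E.Z) :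
    Represents D E (Function.update M (heapStart ρ D + a) v) (σ.put a v) where
  fits := h.fits.update (by omega) (hv.trans (le_wordBound hD _))
  reg y := by
    rw [Function.update_of_ne ((regCell_lt y).trans_le (Nat.le_add_right _ _)).ne]
    exact h.reg y
  heap b := by
    rcases eq_or_ne b a with rfl | hb
    · simp [Store.put]
    · simpa [Store.put, hb] using h.heap b
  reg_le := h.reg_le
  heap_le b := by
    rcases eq_or_ne b a with rfl | hb
    · simpa [Store.put] using hv
    · simpa [Store.put, hb] using h.heap_le b

theorem Yields.heapStart_add_le [DecidableEq ρ] {e : Expr ρ} {m : ℕ} (h : Yields E σ e m)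
    (hi : ∀ a, E.inp.getD a 0 ≤ E.Z) (hr : ∀ x, σ.r x ≤ E.Z) (hh : ∀ a, σ.h a ≤ E.Z)
    (hD : e.size ≤ D) : heapStart ρ D + m ≤ wordBound ρ D E.Z :=
  Nat.add_le_add_left ((h.le hi hr hh).trans (Nat.pow_le_pow_right (by omega) hD)) _

theorem Op.exec_instr (inp : List ℕ) (o : Op) (i j l : ℕ) (M : Mem) :
    (o.instr i j l).exec inp M = {Function.update M i (o.eval (M j) (M l))} := by
  cases o <;> rfl

theorem Represents.total_instr {a : Instr} {t v : ℕ} {Q : Mem → Prop} (hM : Represents D E M σ)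
    (ht : t < D) (hv : v ≤ wordBound ρ D E.Z)
    (ha : a.exec E.inp M = {Function.update M t v})
    (hQ : Represents D E (Function.update M t v) σ → Q (Function.update M t v)) :
    Total E.inp (Fits ρ D E) E.dem 1 ([.instr a], M) Q :=
  HyperAut.total_instr hM.fits ha (hM.update_temp ht hv).fits (hQ (hM.update_temp ht hv))

theorem Represents.total_instr_seq {a : Instr} {p : Prog} {l t v : ℕ} {Q : Mem → Prop}
    (hM : Represents D E M σ) (ht : t < D) (hv : v ≤ wordBound ρ D E.Z)
    (ha : a.exec E.inp M = {Function.update M t v})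
    (h : Represents D E (Function.update M t v) σ →
      Total E.inp (Fits ρ D E) E.dem l ([p], Function.update M t v) Q) :
    Total E.inp (Fits ρ D E) E.dem (l + 2) ([.seq (.instr a) p], M) Q :=
  Total.instr_seq hM.fits ha (h (hM.update_temp ht hv))

variable (D) in
/-- The compiled expression computes the value `m` in the store `σ`, without changing the
represented store and the temporary cells before its own. -/
def Computes (E : Env) (σ : Store ρ) (e : Expr ρ) (m : ℕ) : Prop :=
  ∀ t M, t + e.size ≤ D → Represents D E M σ →
    Total E.inp (Fits ρ D E) E.dem (e.time.eval (E.T + E.Z)) ([e.compile D t], M) fun M' =>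
      Represents D E M' σ ∧ M' t = m ∧ ∀ a < t, M' a = M a

end Compilation

section Correctness

variable {ρ : Type} [Fintype ρ] {D : ℕ} {E : Env} {σ : Store ρ} {M : Mem}

theorem computes_const (c : ℕ) (hc : c ≤ wordBound ρ D E.Z) : Computes D E σ (.const c) c := by
  intro t M ht hM
  simp only [Expr.size] at ht
  simp only [Expr.time, Polynomial.eval_one]
  exact hM.total_instr (by omega) hc rfl
    fun hM' => ⟨hM', by simp, fun a ha => Function.update_of_ne ha.ne _ _⟩

theorem computes_var (x : ρ) (hx : σ.r x ≤ wordBound ρ D E.Z) :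
    Computes D E σ (.var x) (σ.r x) := by
  intro t M ht hM
  simp only [Expr.size] at ht
  simp only [Expr.time, Polynomial.eval_ofNat]
  refine hM.total_instr_seq (l := 1) (by omega) (Nat.zero_le _) rfl fun hM₁ =>
    hM₁.total_instr (t := t) (by omega) hx ?_
      fun hM₂ => ⟨hM₂, by simp, fun a ha => by simp [ha.ne]⟩
  simp [Instr.exec, hM₁.reg x]

theorem Computes.bin {a b : Expr ρ} {m n : ℕ} (o : Op) (ha : Computes D E σ a m)
    (hb : Computes D E σ b n) (hv : o.eval m n ≤ wordBound ρ D E.Z) :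
    Computes D E σ (.bin o a b) (o.eval m n) := by
  intro t M ht hM
  simp only [Expr.size] at ht
  have hapos := a.size_pos
  have hbpos := b.size_pos
  simp only [Expr.time, Polynomial.eval_add, Polynomial.eval_one]
  refine Total.seq hM.fits ((ha t M (by omega) hM).imp fun M₁ ⟨hM₁, hm, hf₁⟩ => ?_)
  refine Total.seq hM₁.fits ((hb (t + 1) M₁ (by omega) hM₁).imp fun M₂ ⟨hM₂, hn, hf₂⟩ => ?_)
  refine hM₂.total_instr (t := t) (by omega) hv ?_ fun hM₃ => ⟨hM₃, by simp, fun c hc => ?_⟩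
  · rw [Op.exec_instr, hn, hf₂ t (by omega), hm]
  · rw [Function.update_of_ne (by omega), hf₂ c (by omega), hf₁ c hc]

theorem Computes.heap {a : Expr ρ} {m : ℕ} (ha : Computes D E σ a m)
    (hm : heapStart ρ D + m ≤ wordBound ρ D E.Z) (hD : D ≠ 0) :
    Computes D E σ (.heap a) (σ.h m) := by
  intro t M ht hM
  simp only [Expr.size] at ht
  have hapos := a.size_pos
  simp only [Expr.time, Polynomial.eval_add, Polynomial.eval_one, Polynomial.eval_ofNat]
  refine Total.seq hM.fits ((ha t M (by omega) hM).imp fun M₁ ⟨hM₁, hm₁, hf₁⟩ => ?_)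
  refine hM₁.total_instr_seq (l := 3) (t := t + 1) (v := heapStart ρ D) (by omega) (by omega) rfl
    fun hM₂ => hM₂.total_instr_seq (l := 1) (t := t) (by omega) hm ?_
    fun hM₃ => hM₃.total_instr (t := t) (v := σ.h m) (by omega)
      ((hM.heap_le m).trans (le_wordBound hD _)) ?_ fun hM₄ => ⟨hM₄, by simp, fun c hc => ?_⟩
  · simp [Instr.exec, hm₁, add_comm]
  · simp only [Instr.exec, Function.update_self, hM₃.heap m]
  · simp [hc.ne, (hc.trans (Nat.lt_succ_self t)).ne, hf₁ c hc]

theorem Computes.input {a : Expr ρ} {m : ℕ} (ha : Computes D E σ a m)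
    (hv : E.inp.getD m 0 ≤ wordBound ρ D E.Z) :
    Computes D E σ (.input a) (E.inp.getD m 0) := by
  intro t M ht hM
  simp only [Expr.size] at ht
  have hapos := a.size_pos
  simp only [Expr.time, Polynomial.eval_add, Polynomial.eval_one]
  refine Total.seq hM.fits ((ha t M (by omega) hM).imp fun M₁ ⟨hM₁, hm, hf⟩ => ?_)
  refine hM₁.total_instr (t := t) (by omega) hv ?_ fun hM₂ => ⟨hM₂, by simp, fun c hc => ?_⟩
  · simp [Instr.exec, hm]
  · rw [Function.update_of_ne (by omega), hf c hc]

theorem Computes.ite {c a b : Expr ρ} {l m : ℕ} (hc : Computes D E σ c l)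
    (ha : l ≠ 0 → Computes D E σ a m) (hb : l = 0 → Computes D E σ b m) :
    Computes D E σ (.ite c a b) m := by
  intro t M ht hM
  simp only [Expr.size] at ht
  simp only [Expr.time, Polynomial.eval_add, Polynomial.eval_one]
  refine Total.seq hM.fits ((hc t M (by omega) hM).imp fun M₁ ⟨hM₁, hl, hf₁⟩ => ?_)
  refine Total.ite hM₁.fits (fun h => ?_) fun h => ?_
  · exact (ha (hl ▸ h) t M₁ (by omega) hM₁).mono (by omega)
      fun M₂ ⟨hM₂, hm, hf₂⟩ => ⟨hM₂, hm, fun d hd => (hf₂ d hd).trans (hf₁ d hd)⟩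
  · exact (hb (hl ▸ h) t M₁ (by omega) hM₁).mono (by omega)
      fun M₂ ⟨hM₂, hm, hf₂⟩ => ⟨hM₂, hm, fun d hd => (hf₂ d hd).trans (hf₁ d hd)⟩

variable [DecidableEq ρ]

theorem Computes.total_foldRound {o : Op} {x : ρ} {e : Expr ρ} {t r i acc v : ℕ}
    (he : Computes D E (σ.set x i) e v) (ht : t + (e.size + 3) ≤ D) (hi : i + 1 ≤ E.Z)
    (hv : o.eval acc v ≤ E.Z) (hM : Represents D E M (σ.set x i)) (hr : M t = r + 1)
    (hacc : M (t + 1) = acc) :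
    Total E.inp (Fits ρ D E) E.dem (e.time.eval (E.T + E.Z) + 7 + 1)
      ([foldRound D o x t (e.compile D (t + 3))], M) fun M' =>
        Represents D E M' (σ.set x (i + 1)) ∧ M' t = r ∧ M' (t + 1) = o.eval acc v ∧
          M' (t + 2) = M (t + 2) ∧ ∀ a < t, M' a = M a := by
  have hZ : E.Z ≤ wordBound ρ D E.Z := le_wordBound (by omega) _
  have hpos := e.size_pos
  have hx := le_regCell (D := D) x
  have hone : 1 ≤ wordBound ρ D E.Z := (Nat.le_add_left 1 i).trans (hi.trans hZ)
  refine Total.seq hM.fits ((he (t + 3) M (by omega) hM).imp fun M₁ ⟨hM₁, hv₁, hf⟩ => ?_)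
  have hr₁ : M₁ t = r + 1 := by rw [hf t (by omega), hr]
  have hacc₁ : M₁ (t + 1) = acc := by rw [hf (t + 1) (by omega), hacc]
  have hrle : r ≤ wordBound ρ D E.Z := by have := hM₁.fits.1 t; omega
  refine hM₁.total_instr_seq (l := 5) (t := t + 1) (v := o.eval acc v) (by omega) (hv.trans hZ)
    (by rw [Op.exec_instr, hacc₁, hv₁])
    fun hM₂ => hM₂.total_instr_seq (l := 3) (t := t + 3) (by omega) hone rfl
    fun hM₃ => hM₃.total_instr_seq (l := 1) (t := t) (v := r) (by omega) hrle
      (by simp [Instr.exec, hr₁]) fun hM₄ => ?_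
  have hM₅ := hM₄.update_regCell (x := x) (by omega) hi
  rw [Store.set_set] at hM₅
  refine total_instr hM₄.fits ?_ hM₅.fits ⟨hM₅, ?_, ?_, ?_, fun a ha => ?_⟩
  · have hreg := hM₄.reg x
    simp only [Store.set, Function.update_self] at hreg
    simp [Instr.exec, hreg]
  · rw [Function.update_of_ne (by omega), Function.update_self]
  · rw [Function.update_of_ne (by omega)]; simp
  · rw [Function.update_of_ne (by omega)]; simp [hf]
  · rw [Function.update_of_ne (by omega), Function.update_of_ne (by omega),
      Function.update_of_ne (by omega), Function.update_of_ne (by omega), hf a (by omega)]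

theorem total_loop_foldRound {o : Op} {c : ℕ} {x : ρ} {e : Expr ρ} {t N : ℕ} {f : ℕ → ℕ}
    (he : ∀ i < N, Computes D E (σ.set x i) e (f i)) (ht : t + (e.size + 3) ≤ D) (hN : N ≤ E.Z)
    (hf : ∀ i ≤ N, foldValue o c f i ≤ E.Z) {i r : ℕ} (hir : i + r = N)
    (hM : Represents D E M (σ.set x i)) (hr : M t = r) (hacc : M (t + 1) = foldValue o c f i) :
    Total E.inp (Fits ρ D E) E.dem (r * (e.time.eval (E.T + E.Z) + 9) + 1)
      ([.loop t (foldRound D o x t (e.compile D (t + 3)))], M) fun M' =>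
        Represents D E M' (σ.set x N) ∧ M' t = 0 ∧ M' (t + 1) = foldValue o c f N ∧
          M' (t + 2) = M (t + 2) ∧ ∀ a < t, M' a = M a := by
  induction r generalizing i M with
  | zero =>
    obtain rfl : i = N := hir
    simpa using total_loop_of_eq_zero hM.fits hr ⟨hM, hr, hacc, rfl, fun _ _ => rfl⟩
  | succ r ih =>
    have hround := (he i (by omega)).total_foldRound (o := o) ht (by omega)
      (hf (i + 1) (by omega)) hM hr hacc
    refine (Total.loop_of_ne_zero hM.fits (by omega) (hround.imp
      fun M₁ ⟨hM₁, hr₁, hacc₁, hsave₁, hf₁⟩ => (ih (by omega) hM₁ hr₁ hacc₁).imp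
      fun M₂ ⟨hM₂, hr₂, hacc₂, hsave₂, hf₂⟩ => ⟨hM₂, hr₂, hacc₂, hsave₂.trans hsave₁,
        fun a ha => (hf₂ a ha).trans (hf₁ a ha)⟩)).weaken ?_
    rw [Nat.succ_mul]
    omega

theorem Represents.total_fold_exit {x : ρ} {t N m : ℕ} {M₀ : Mem} (ht : t + 2 < D)
    (hx : σ.r x ≤ E.Z) (hm : m ≤ E.Z) (hM : Represents D E M (σ.set x N)) (hzero : M t = 0)
    (hacc : M (t + 1) = m) (hsave : M (t + 2) = σ.r x) (hf : ∀ a < t, M a = M₀ a) :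
    Total E.inp (Fits ρ D E) E.dem 3
      ([.seq (.instr (.add (regCell D x) t (t + 2))) (.instr (.add t t (t + 1)))], M) fun M' =>
        Represents D E M' σ ∧ M' t = m ∧ ∀ a < t, M' a = M₀ a := by
  have hxD := le_regCell (D := D) x
  have hM₁ := hM.update_regCell (x := x) (by omega) hx
  rw [Store.set_set, Store.set_eq_self] at hM₁
  refine Total.instr_seq (t := 1) (M' := Function.update M (regCell D x) (σ.r x)) hM.fits ?_
    (hM₁.total_instr (t := t) (v := m) (by omega) (hm.trans (le_wordBound (by omega) _)) ?_
    fun hM₂ => ⟨hM₂, by simp, fun a ha => ?_⟩)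
  · simp [Instr.exec, hzero, hsave]
  · simp only [Instr.exec]
    rw [Function.update_of_ne (by omega), Function.update_of_ne (by omega), hzero, hacc, zero_add]
  · rw [Function.update_of_ne (by omega), Function.update_of_ne (by omega), hf a ha]

theorem Computes.fold {x : ρ} {n e : Expr ρ} {N : ℕ} (o : Op) (c : ℕ) (f : ℕ → ℕ)
    (hn : Computes D E σ n N) (hN : N ≤ E.Z) (he : ∀ i < N, Computes D E (σ.set x i) e (f i))
    (hf : ∀ i ≤ N, foldValue o c f i ≤ E.Z) :
    Computes D E σ (.fold o c x n e) (foldValue o c f N) := by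
  intro t M ht hM
  simp only [Expr.size] at ht
  have hZ : E.Z ≤ wordBound ρ D E.Z := le_wordBound (by omega) _
  have hpos := n.size_pos
  have hx := le_regCell (D := D) x
  have htime : N * (e.time.eval (E.T + E.Z) + 9) ≤ (E.T + E.Z) * (e.time.eval (E.T + E.Z) + 9) :=
    Nat.mul_le_mul_right _ (hN.trans (Nat.le_add_left _ _))
  simp only [Expr.time, Polynomial.eval_add, Polynomial.eval_one, Polynomial.eval_mul,
    Polynomial.eval_X, Polynomial.eval_ofNat]
  refine Total.seq hM.fits ((hn t M (by omega) hM).imp fun M₁ ⟨hM₁, hN₁, hf₁⟩ => ?_)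
  have hc : c ≤ wordBound ρ D E.Z := (hf 0 (Nat.zero_le N)).trans hZ
  refine (hM₁.total_instr_seq (t := t + 1) (by omega) hc rfl
    fun hM₂ => hM₂.total_instr_seq (t := t + 2) (by omega) (Nat.zero_le _) rfl
    fun hM₃ => hM₃.total_instr_seq (t := t + 2) (v := σ.r x) (by omega) ((hM.reg_le x).trans hZ)
      (by simp [Instr.exec, hM₃.reg x]) fun hM₄ => ?_).weaken
    (t := N * (e.time.eval (E.T + E.Z) + 9) + 13) (by omega)
  have hM₅ := hM₄.update_regCell (x := x) (by omega) (Nat.zero_le E.Z)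
  refine Total.instr_seq hM₄.fits rfl (Total.seq (t' := 3) hM₅.fits
    ((total_loop_foldRound he (by omega) hN hf (Nat.zero_add N) hM₅ ?_ ?_).imp
    fun M₆ ⟨hM₆, ht₆, hacc₆, hsave₆, hf₆⟩ => ?_))
  · rw [Function.update_of_ne (by omega)]
    simp [hN₁]
  · rw [Function.update_of_ne (by omega)]
    simp [foldValue]
  rw [Function.update_of_ne (by omega), Function.update_self] at hsave₆
  refine hM₆.total_fold_exit (t := t) (by omega) (hM.reg_le x) (hf N le_rfl) ht₆ hacc₆ hsave₆
    fun a ha => ?_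
  rw [hf₆ a ha, Function.update_of_ne (by omega), Function.update_of_ne (by omega),
    Function.update_of_ne (by omega), Function.update_of_ne (by omega), hf₁ a ha]

theorem Yields.computes {e : Expr ρ} {m : ℕ} (h : Yields E σ e m)
    (hi : ∀ a, E.inp.getD a 0 ≤ E.Z) (hr : ∀ x, σ.r x ≤ E.Z) (hh : ∀ a, σ.h a ≤ E.Z)
    (hD : e.size ≤ D) : Computes D E σ e m := by
  have le_wordBound {σ : Store ρ} {e : Expr ρ} {m : ℕ} (h : Yields E σ e m)
      (hr : ∀ x, σ.r x ≤ E.Z) (hh : ∀ a, σ.h a ≤ E.Z) (hD : e.size ≤ D) :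
      m ≤ wordBound ρ D E.Z :=
    (Nat.le_add_left _ _).trans (h.heapStart_add_le hi hr hh hD)
  induction h with
  | const c => exact computes_const c (le_wordBound (.const c) hr hh hD)
  | var x => exact computes_var x (le_wordBound (.var x) hr hh hD)
  | bin o ha hb iha ihb =>
    have hle := le_wordBound (.bin o ha hb) hr hh hD
    simp only [Expr.size] at hD
    exact (iha hr hh (by omega)).bin o (ihb hr hh (by omega)) hle
  | @heap _ a _ ha ih =>
    simp only [Expr.size] at hD
    have hpos := a.size_pos
    exact (ih hr hh (by omega)).heap (ha.heapStart_add_le hi hr hh (by omega)) (by omega)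
  | input ha ih =>
    have hle := le_wordBound (.input ha) hr hh hD
    simp only [Expr.size] at hD
    exact (ih hr hh (by omega)).input hle
  | ite_true _ hl _ ihc iha =>
    simp only [Expr.size] at hD
    exact (ihc hr hh (by omega)).ite (fun _ => iha hr hh (by omega)) fun h => absurd h hl
  | ite_false _ _ ihc ihb =>
    simp only [Expr.size] at hD
    exact (ihc hr hh (by omega)).ite (fun h => absurd rfl h) fun _ => ihb hr hh (by omega)
  | @fold σ x _ _ _ o c f _ hN _ hf ihn ihe =>
    simp only [Expr.size] at hD
    refine (ihn hr hh (by omega)).fold o c f hN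
      (fun i hi => ihe i hi (fun y => ?_) hh (by omega)) hf
    rcases eq_or_ne y x with rfl | hy
    · simpa [Store.set] using hi.le.trans hN
    · simpa [Store.set, hy] using hr y

end Correctness

section Execution

variable {ρ : Type} [Fintype ρ] [DecidableEq ρ] {D : ℕ} {E : Env} {σ : Store ρ} {M : Mem}
  {Q : Store ρ → Prop}

theorem Represents.total_expr {e : Expr ρ} {m t : ℕ} (hM : Represents D E M σ)
    (hi : ∀ a, E.inp.getD a 0 ≤ E.Z) (he : Yields E σ e m) (ht : t + e.size ≤ D) :
    Total E.inp (Fits ρ D E) E.dem (e.time.eval (E.T + E.Z)) ([e.compile D t], M) fun M' =>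
      Represents D E M' σ ∧ M' t = m ∧ ∀ a < t, M' a = M a :=
  he.computes hi hM.reg_le hM.heap_le (by omega) t M ht hM

variable (D) in
/-- The compiled statement establishes `Q` when started in a representation of `σ`. -/
def Executes (E : Env) (p : Stm ρ) (σ : Store ρ) (Q : Store ρ → Prop) : Prop :=
  ∀ M, Represents D E M σ →
    Total E.inp (Fits ρ D E) E.dem (p.time.eval (E.T + E.Z)) ([p.compile D], M) fun M' =>
      ∃ σ', Represents D E M' σ' ∧ Q σ'

theorem executes_assign {x : ρ} {e : Expr ρ} (hi : ∀ a, E.inp.getD a 0 ≤ E.Z)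
    (hD : (Stm.assign x e).size ≤ D) (h : wp E (.assign x e) σ Q) :
    Executes D E (.assign x e) σ Q := by
  intro M hM
  obtain ⟨m, he, hm, hQ⟩ := h
  simp only [Stm.size] at hD
  simp only [Stm.time, Polynomial.eval_add, Polynomial.eval_one, Polynomial.eval_ofNat]
  refine Total.seq hM.fits ((hM.total_expr hi he (by omega)).imp fun M₁ ⟨hM₁, hm₁, _⟩ => ?_)
  refine hM₁.total_instr_seq (l := 1) (t := 1) (by omega) (Nat.zero_le _) rfl fun hM₂ => ?_
  have hM₃ := hM₂.update_regCell (x := x) (by omega) hm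
  refine total_instr hM₂.fits ?_ hM₃.fits ⟨_, hM₃, hQ⟩
  simp [Instr.exec, hm₁]

theorem executes_store {a e : Expr ρ} (hi : ∀ a, E.inp.getD a 0 ≤ E.Z)
    (hD : (Stm.store a e).size ≤ D) (h : wp E (.store a e) σ Q) :
    Executes D E (.store a e) σ Q := by
  intro M hM
  obtain ⟨l, m, ha, he, hl, hm, hQ⟩ := h
  simp only [Stm.size] at hD
  have hapos := a.size_pos
  have hbase := ha.heapStart_add_le hi hM.reg_le hM.heap_le (D := D) (by omega)
  simp only [Stm.time, Polynomial.eval_add, Polynomial.eval_one, Polynomial.eval_ofNat]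
  refine Total.seq hM.fits ((hM.total_expr hi ha (by omega)).imp fun M₁ ⟨hM₁, hl₁, _⟩ => ?_)
  refine Total.seq hM₁.fits ((hM₁.total_expr hi he (by omega)).imp fun M₂ ⟨hM₂, hm₂, hf₂⟩ => ?_)
  refine hM₂.total_instr_seq (l := 3) (t := 2) (v := heapStart ρ D) (by omega) (by omega) rfl
    fun hM₃ => hM₃.total_instr_seq (l := 1) (t := 0) (by omega) hbase ?_ fun hM₄ => ?_
  · simp [Instr.exec, hf₂ 0 Nat.zero_lt_one, hl₁, add_comm]
  have hM₅ := hM₄.update_heap (by omega) hl hm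
  refine total_instr hM₄.fits ?_ hM₅.fits ⟨_, hM₅, hQ⟩
  simp [Instr.exec, hm₂]

theorem executes_guess {x : ρ} {e : Expr ρ} (hi : ∀ a, E.inp.getD a 0 ≤ E.Z)
    (hD : (Stm.guess x e).size ≤ D) (h : wp E (.guess x e) σ Q) :
    Executes D E (.guess x e) σ Q := by
  intro M hM
  obtain ⟨m, he, hm, hQ⟩ := h
  simp only [Stm.size] at hD
  have hpos := e.size_pos
  simp only [Stm.time, Polynomial.eval_add, Polynomial.eval_one]
  refine Total.seq hM.fits ((hM.total_expr hi he (by omega)).imp fun M₁ ⟨hM₁, hm₁, _⟩ => ?_)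
  have hset {v : ℕ} (hv : v ≤ m) := hM₁.update_regCell (x := x) (by omega) (hv.trans hm)
  refine ⟨hM₁.fits, Or.inr ⟨by simp, ?_⟩⟩
  cases hd : E.dem with
  | true =>
    rw [hd] at hQ
    rintro c ⟨M', ⟨v, hv, rfl⟩, rfl⟩
    rw [hm₁] at hv
    exact total_nil (hset hv).fits ⟨_, hset hv, hQ v hv⟩
  | false =>
    rw [hd] at hQ
    obtain ⟨v, hv, hQ⟩ := hQ
    exact ⟨_, ⟨_, ⟨v, by rwa [hm₁], rfl⟩, rfl⟩, total_nil (hset hv).fits ⟨_, hset hv, hQ⟩⟩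

theorem total_expr_loop {e : Expr ρ} {p : Stm ρ} {n : ℕ} (hi : ∀ a, E.inp.getD a 0 ≤ E.Z)
    (hD : e.size ≤ D) (hp : ∀ σ Q, wp E p σ Q → Executes D E p σ Q)
    (hM : Represents D E M σ) (h : wpLoop E e (wp E p) n σ Q) :
    Total E.inp (Fits ρ D E) E.dem
      (e.time.eval (E.T + E.Z) +
        (n * (p.time.eval (E.T + E.Z) + e.time.eval (E.T + E.Z) + 2) + 1))
      ([e.compile D 0, .loop 0 (.seq (p.compile D) (e.compile D 0))], M) fun M' =>
        ∃ σ', Represents D E M' σ' ∧ Q σ' := by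
  induction n generalizing σ M with
  | zero =>
    refine Total.append (K := [_])
      ((hM.total_expr hi h.1 (by omega)).imp fun M₁ ⟨hM₁, hm₁, _⟩ => ?_)
    exact (total_loop_of_eq_zero hM₁.fits hm₁ ⟨σ, hM₁, h.2⟩).weaken (by omega)
  | succ n ih =>
    obtain ⟨m, he, hexit, hround⟩ := h
    refine Total.append (K := [_])
      ((hM.total_expr hi he (by omega)).imp fun M₁ ⟨hM₁, hm₁, _⟩ => ?_)
    by_cases hm : m = 0
    · exact (total_loop_of_eq_zero hM₁.fits (hm₁.trans hm) ⟨σ, hM₁, hexit hm⟩).weaken (by omega)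
    · have hbody := Total.append (K := [_])
        ((hp _ _ (hround hm) M₁ hM₁).imp fun M₂ ⟨σ₂, hM₂, h₂⟩ => ih hM₂ h₂)
      have hround' := Total.of_next_eq (inp := E.inp)
        (c := ([.seq (p.compile D) (e.compile D 0), .loop 0 (.seq (p.compile D) (e.compile D 0))],
          M₁)) hM₁.fits (by simp) rfl hbody
      refine (Total.of_next_eq hM₁.fits (by simp) ?_ hround').weaken (by rw [add_mul]; omega)
      simp [Config.next, hm₁, hm]

theorem Stm.executes (p : Stm ρ) (hi : ∀ a, E.inp.getD a 0 ≤ E.Z) (hD : p.size ≤ D)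
    (h : wp E p σ Q) : Executes D E p σ Q := by
  induction p generalizing σ Q with
  | assign x e => exact executes_assign hi hD h
  | store a e => exact executes_store hi hD h
  | guess x e => exact executes_guess hi hD h
  | seq p q ihp ihq =>
    intro M hM
    simp only [Stm.size] at hD
    simp only [Stm.time, Polynomial.eval_add, Polynomial.eval_one]
    exact Total.seq hM.fits ((ihp (by omega) h M hM).imp fun M₁ ⟨σ₁, hM₁, h₁⟩ =>
      ihq (by omega) h₁ M₁ hM₁)
  | ite e p q ihp ihq =>
    intro M hM
    obtain ⟨m, he, hp, hq⟩ := h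
    simp only [Stm.size] at hD
    simp only [Stm.time, Polynomial.eval_add, Polynomial.eval_one]
    refine Total.seq hM.fits
      ((hM.total_expr hi he (by omega)).imp fun M₁ ⟨hM₁, hm₁, _⟩ => ?_)
    exact Total.ite hM₁.fits
      (fun hm => (ihp (by omega) (hp (by rwa [← hm₁])) M₁ hM₁).weaken (by omega))
      (fun hm => (ihq (by omega) (hq (by rwa [← hm₁])) M₁ hM₁).weaken (by omega))
  | loop e p ih =>
    intro M hM
    simp only [Stm.size] at hD
    simp only [Stm.time, Polynomial.eval_add, Polynomial.eval_mul, Polynomial.eval_X,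
      Polynomial.eval_one, Polynomial.eval_ofNat]
    have hrun := total_expr_loop hi (by omega) (fun _ _ h => ih (by omega) h) hM h
    refine (Total.of_next_eq hM.fits (by simp) rfl hrun).weaken ?_
    gcongr
    omega

theorem Stm.total_compile (p : Stm ρ) (ans : ρ) (hi : ∀ a, E.inp.getD a 0 ≤ E.Z)
    (hD : p.size < D) (h : wp E p ⟨fun _ => 0, fun _ => 0⟩ Q) :
    Total E.inp (Fits ρ D E) E.dem (p.time.eval (E.T + E.Z) + 3 + 1)
      ([.seq (p.compile D) ((Expr.var ans).compile D 0)], fun _ => 0) fun M =>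
        ∃ σ, M 0 = σ.r ans ∧ Q σ := by
  have hM : Represents D E (fun _ => 0) (⟨fun _ => 0, fun _ => 0⟩ : Store ρ) := by
    refine ⟨⟨?_, ?_⟩, ?_, ?_, ?_, ?_⟩ <;> simp
  exact Total.seq hM.fits ((p.executes hi hD.le h _ hM).imp fun M' ⟨σ, hM', hQ⟩ =>
    (hM'.total_expr hi (.var ans) (by simp only [Expr.size]; omega)).mono (by simp [Expr.time])
      fun M'' ⟨_, hm, _⟩ => ⟨σ, hm, hQ⟩)

end Execution

/-- `Implements P p ans C q`: the program `P` executes the statement `p`, starting with zeros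
everywhere, and returns the register `ans`. Here `q` bounds its time, and `C` its overhead in
space and in the exponent of the bound for its words. -/
structure Implements {ρ : Type} [DecidableEq ρ] (P : Prog) (p : Stm ρ) (ans : ρ) (C : ℕ)
    (q : Polynomial ℕ) : Prop where
  deterministic : p.NoGuess → P.Deterministic
  demonic : ∀ (inp : List ℕ) (Z H T : ℕ) (Q : Store ρ → Prop), (∀ a, inp.getD a 0 ≤ Z) →
    wp ⟨inp, Z, H, T, true⟩ p ⟨fun _ => 0, fun _ => 0⟩ Q →
    HaltsWithin P inp (q.eval (T + Z)) ∧ WordsAtMost P inp ((Z + 2) ^ C) ∧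
    SpaceAtMost P inp (C + H : ℕ) ∧
    ∀ t M, Run P inp t ([], M) → ∃ σ, M 0 = σ.r ans ∧ Q σ
  angelic : ∀ (inp : List ℕ) (Z H T : ℕ) (Q : Store ρ → Prop), (∀ a, inp.getD a 0 ≤ Z) →
    wp ⟨inp, Z, H, T, false⟩ p ⟨fun _ => 0, fun _ => 0⟩ Q →
    ∃ t M, Run P inp t ([], M) ∧ ∃ σ, M 0 = σ.r ans ∧ Q σ

theorem Stm.exists_implements {ρ : Type} [Finite ρ] [DecidableEq ρ] (p : Stm ρ) (ans : ρ) :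
    ∃ P C q, Implements P p ans C q := by
  cases nonempty_fintype ρ
  obtain ⟨D, hD⟩ : ∃ D, D = p.size + 1 := ⟨_, rfl⟩
  refine ⟨.seq (p.compile D) ((Expr.var ans).compile D 0), D + heapStart ρ D, p.time + 3 + 1,
    fun h => ⟨p.deterministic_compile D h, Expr.deterministic_compile D _ 0⟩,
    fun inp Z H T Q hi h => ?_,
    fun inp Z H T Q hi h => (p.total_compile (E := ⟨inp, Z, H, T, false⟩) (D := D) ans hi
      (by omega) h).exists_run⟩
  have htotal := p.total_compile (E := ⟨inp, Z, H, T, true⟩) (D := D) ans hi (by omega) h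
  have hfits {t : ℕ} {c : Config} (hr : Run _ inp t c) := (htotal.of_run hr).2.ok_mem
  have hwords : wordBound ρ D Z ≤ (Z + 2) ^ (D + heapStart ρ D) := by
    rw [add_comm D]
    have hpos : 0 < heapStart ρ D := by unfold heapStart; omega
    exact Op.add.eval_le_pow (Nat.le_add_left 2 Z) hpos (by omega)
      (Nat.lt_pow_self (by omega)).le le_rfl
  refine ⟨fun t c hr => ?_, fun t c hr a => ((hfits hr).1 a).trans hwords, fun t c hr a ha => ?_,
    fun t M hr => (htotal.of_run hr).2.post⟩
  · simpa using (htotal.of_run hr).1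
  · have ha : D + heapStart ρ D + H ≤ a := by exact_mod_cast ha
    exact (hfits hr).2 a (by dsimp only; omega)

/-! ### Derived constructs -/

section Derived

infix:60 " ≔ " => Stm.assign
infixr:55 " ;; " => Stm.seq

variable {ρ : Type}

instance (n : ℕ) : OfNat (Expr ρ) n := ⟨.const n⟩
instance : Add (Expr ρ) := ⟨.bin .add⟩
instance : Sub (Expr ρ) := ⟨.bin .sub⟩
instance : Mul (Expr ρ) := ⟨.bin .mul⟩
instance : Div (Expr ρ) := ⟨.bin .div⟩
instance : Mod (Expr ρ) := ⟨.bin .mod⟩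

/-- The sum of the values of `e` for `x = 0, …, n - 1`. -/
def Expr.sum (x : ρ) (n e : Expr ρ) : Expr ρ := .fold .add 0 x n e

/-- The number of values `x = 0, …, n - 1` for which `c` is not zero. -/
def Expr.count (x : ρ) (n c : Expr ρ) : Expr ρ := .sum x n (.ite c 1 0)

/-- The power `a ^ n`, computed with a bound variable `x` that does not occur in `a`. -/
def Expr.pow (x : ρ) (a n : Expr ρ) : Expr ρ := .fold .mul 1 x n a

/-- The statement `p` executed for `x = 0, …, n - 1`. -/
def Stm.for (x : ρ) (n : Expr ρ) (p : Stm ρ) : Stm ρ :=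
  x ≔ 0 ;; .loop (n - .var x) (p ;; x ≔ .var x + 1)

variable [DecidableEq ρ] {E : Env} {σ : Store ρ} {a b c : Expr ρ} {l m n : ℕ} {x : ρ}

theorem yields_ofNat (n : ℕ) : Yields E σ (OfNat.ofNat n) n := .const n

theorem Yields.add (ha : Yields E σ a m) (hb : Yields E σ b n) : Yields E σ (a + b) (m + n) :=
  .bin .add ha hb

theorem Yields.sub (ha : Yields E σ a m) (hb : Yields E σ b n) : Yields E σ (a - b) (m - n) :=
  .bin .sub ha hb

theorem Yields.mul (ha : Yields E σ a m) (hb : Yields E σ b n) : Yields E σ (a * b) (m * n) :=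
  .bin .mul ha hb

theorem Yields.div (ha : Yields E σ a m) (hb : Yields E σ b n) : Yields E σ (a / b) (m / n) :=
  .bin .div ha hb

theorem Yields.mod (ha : Yields E σ a m) (hb : Yields E σ b n) : Yields E σ (a % b) (m % n) :=
  .bin .mod ha hb

theorem Yields.ite {P : Prop} [Decidable P] (hc : Yields E σ c l) (hP : P ↔ l ≠ 0)
    (ha : P → Yields E σ a m) (hb : ¬ P → Yields E σ b n) :
    Yields E σ (.ite c a b) (if P then m else n) := by
  split_ifs with h
  · exact .ite_true hc (hP.1 h) (ha h)
  · obtain rfl : l = 0 := by simpa [hP] using h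
    exact .ite_false hc (hb h)

theorem Yields.sum {f : ℕ → ℕ} (hb : Yields E σ b n) (hn : n ≤ E.Z)
    (ha : ∀ i < n, Yields E (σ.set x i) a (f i)) (hf : ∑ i ∈ Finset.range n, f i ≤ E.Z) :
    Yields E σ (.sum x b a) (∑ i ∈ Finset.range n, f i) := by
  rw [← foldValue_add]
  refine .fold .add 0 f hb hn ha fun i hi => ?_
  rw [foldValue_add]
  exact (Finset.sum_le_sum_of_subset (Finset.range_subset_range.2 hi)).trans hf

theorem Yields.exists_count {P : ℕ → Prop} (hb : Yields E σ b n) (hn : n ≤ E.Z)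
    (hc : ∀ i < n, ∃ m, Yields E (σ.set x i) c m ∧ (m ≠ 0 ↔ P i)) :
    ∃ m ≤ n, Yields E σ (.count x b c) m ∧ (m ≠ 0 ↔ ∃ i < n, P i) := by
  classical
  choose! f hf hP using hc
  have hle : ∑ i ∈ Finset.range n, (if P i then 1 else 0) ≤ n :=
    (Finset.sum_le_card_nsmul _ _ 1 fun i _ => by split_ifs <;> omega).trans (by simp)
  exact ⟨_, hle, .sum hb hn (fun i hi => .ite (hf i hi) (hP i hi).symm
    (fun _ => yields_ofNat 1) fun _ => yields_ofNat 0) (hle.trans hn), by simp⟩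

theorem pow_le_of_le_pow {b i j z : ℕ} (hz : 1 ≤ z) (hij : i ≤ j) (h : b ^ j ≤ z) : b ^ i ≤ z := by
  rcases b.eq_zero_or_pos with rfl | hb
  · exact (zero_pow_le_one i).trans hz
  · exact (Nat.pow_le_pow_right hb hij).trans h

theorem Yields.pow (hE : 1 ≤ E.Z) (ha : ∀ σ, Yields E σ a m) (hb : Yields E σ b n) (hn : n ≤ E.Z)
    (hm : m ^ n ≤ E.Z) : Yields E σ (.pow x a b) (m ^ n) := by
  rw [← foldValue_mul]
  refine .fold .mul 1 _ hb hn (fun i _ => ha _) fun i hi => ?_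
  rw [foldValue_mul]
  exact pow_le_of_le_pow hE hi hm

variable {p q : Stm ρ} {P Q : Store ρ → Prop}

theorem wp_assign (ha : Yields E σ a m) (hm : m ≤ E.Z) (hQ : Q (σ.set x m)) :
    wp E (x ≔ a) σ Q :=
  ⟨m, ha, hm, hQ⟩

theorem wp_store (ha : Yields E σ a l) (hb : Yields E σ b m) (hl : l < E.H) (hm : m ≤ E.Z)
    (hQ : Q (σ.put l m)) : wp E (.store a b) σ Q :=
  ⟨l, m, ha, hb, hl, hm, hQ⟩

theorem wp_seq (hp : wp E p σ P) (hq : ∀ σ, P σ → wp E q σ Q) : wp E (p ;; q) σ Q :=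
  wp_mono (p := p) hp hq

theorem wp_for (I : ℕ → Store ρ → Prop)
    (hb : ∀ σ, Yields E σ b n) (hZ : n ≤ E.Z) (hT : n ≤ E.T) (h0 : I 0 (σ.set x 0))
    (hs : ∀ i σ, i < n → σ.r x = i → I i σ →
      wp E p σ fun σ' => σ'.r x = i ∧ I (i + 1) (σ'.set x (i + 1)))
    (hQ : ∀ σ, I n σ → Q σ) : wp E (.for x b p) σ Q := by
  refine wp_seq (wp_assign (yields_ofNat 0) (Nat.zero_le _) ⟨by simp [Store.set], h0⟩) fun σ h0 =>
    wp_loop_count n (fun i σ => σ.r x = i ∧ I i σ) hT h0 ?_ ?_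
  · rintro i σ hi ⟨rfl, hI⟩
    refine ⟨⟨_, by omega, (hb σ).sub (.var x)⟩, wp_seq (hs _ σ hi rfl hI) ?_⟩
    rintro σ' ⟨hx, hI'⟩
    refine wp_assign ((Yields.var x).add (yields_ofNat 1)) (by omega) ⟨by simp [Store.set, hx], ?_⟩
    rwa [hx]
  · rintro σ ⟨hx, hI⟩
    refine ⟨?_, hQ σ hI⟩
    have hcount := (hb σ).sub (.var x)
    rwa [hx, Nat.sub_self] at hcount

end Derived

/-! ### Evaluation of the product -/

section Product

/-- The registers of the decision programs: bound variables for product states, rows of the table,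
copies, components, letters and exponents, a carry, and the result. -/
inductive Reg where
  | state | row | copy | component | letter | exponent | carry | result
  deriving DecidableEq

instance : Fintype Reg :=
  Fintype.ofList [.state, .row, .copy, .component, .letter, .exponent, .carry, .result]
    fun x => by cases x <;> simp

/-- Expressions that locate the two automata of the product in the input: their arities, and the
positions of their encodings. -/
structure Operands where
  arityA : Expr Reg
  arityB : Expr Reg
  posA : Expr Reg
  posB : Expr Reg

/-- The size of the alphabet. -/
def alphabetSize : Expr Reg := .input 0

namespace Operands

variable (O : Operands)

/-- The number of letters of the watched automaton. -/
def letterCount : Expr Reg := .pow .exponent alphabetSize O.arityA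

/-- The number of copies. -/
def copyCount : Expr Reg := .pow .exponent O.arityA O.arityB

/-- The number of states of the watched automaton. -/
def sizeA : Expr Reg := .input O.posA

/-- The number of states of the copied automaton. -/
def sizeB : Expr Reg := .input O.posB

/-- The letter that the current copy reads, see `letter`. -/
def copyLetter : Expr Reg :=
  .sum .component O.arityB
    (.var .letter / .pow .exponent alphabetSize
      (.var .copy / .pow .exponent O.arityA (.var .component) % O.arityA) % alphabetSize *
        .pow .exponent alphabetSize (.var .component))

/-- The number of accepting copies, where `d` is the state of the current copy. -/
def badCount (d : Expr Reg) : Expr Reg :=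
  .count .copy O.copyCount (.ite (O.sizeB - d) (.input (O.posB + 2 + d)) 0)

/-- The successor of the state `d` of the current copy under the current letter. -/
def copyStep (d : Expr Reg) : Expr Reg :=
  .ite (O.sizeB - d)
    (.input (O.posB + 2 + O.sizeB + d * .pow .exponent alphabetSize O.arityB + O.copyLetter)) d

/-- The successor of the first component `w` under the current letter. -/
def watchStep (w : Expr Reg) : Expr Reg :=
  .ite (O.sizeA - w) (.ite (.input (O.posA + 2 + w)) (O.sizeA + 1)
    (.input (O.posA + 2 + O.sizeA + w * O.letterCount + .var .letter))) w

end Operands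

variable {s k k' n n' a b : ℕ} {E : Env} {O : Operands} {A : DetAut (Fin k → Fin s) n}
  {B : DetAut (Fin k' → Fin s) n'} {σ : Store Reg} {d w : Expr Reg}

/-- The operands locate the automata `A` and `B`, at the positions `a` and `b`, and the values that
occur in the product are within the bound for registers. -/
structure Locates (E : Env) (O : Operands) (a b : ℕ) (A : DetAut (Fin k → Fin s) n)
    (B : DetAut (Fin k' → Fin s) n') : Prop where
  alphabetSize : ∀ σ, Yields E σ alphabetSize s
  arityA : ∀ σ, Yields E σ O.arityA k
  arityB : ∀ σ, Yields E σ O.arityB k'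
  posA : ∀ σ, Yields E σ O.posA a
  posB : ∀ σ, Yields E σ O.posB b
  encodesA : Encodes E.inp a A
  encodesB : Encodes E.inp b B
  bound : k + k' + s ^ k + s ^ k' + 2 * k ^ k' + n + n' + 3 ≤ E.Z

variable (E) in
/-- The expressions `d`, for the current copy, and `w` evaluate to the digits of `x`. -/
structure Reads (σ : Store Reg) (d w : Expr Reg) (x : ProdState k k' n n') : Prop where
  copies : ∀ i < k ^ k', Yields E (σ.set .copy i) d (digit x i)
  watch : Yields E σ w (digit x (k ^ k'))

namespace Locates

theorem letterCount (h : Locates E O a b A B) (σ : Store Reg) :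
    Yields E σ O.letterCount (s ^ k) := by
  have := h.bound
  exact .pow (by omega) h.alphabetSize (h.arityA σ) (by omega) (by omega)

theorem copyCount (h : Locates E O a b A B) (σ : Store Reg) :
    Yields E σ O.copyCount (k ^ k') := by
  have := h.bound
  exact .pow (by omega) h.arityA (h.arityB σ) (by omega) (by omega)

theorem sizeA (h : Locates E O a b A B) (σ : Store Reg) : Yields E σ O.sizeA n :=
  h.encodesA.size ▸ .input (h.posA σ)

theorem sizeB (h : Locates E O a b A B) (σ : Store Reg) : Yields E σ O.sizeB n' :=
  h.encodesB.size ▸ .input (h.posB σ)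

theorem copyLetter (h : Locates E O a b A B) {v : Fin k → Fin s} (hi : σ.r .copy < k ^ k')
    (hv : σ.r .letter = finFunctionFinEquiv v) :
    Yields E σ O.copyLetter (letter s k k' (σ.r .copy) (finFunctionFinEquiv v)) := by
  have := h.bound
  have power {σ : Store Reg} {e : Expr Reg} {j : ℕ} (he : Yields E σ e j) (hj : j ≤ k) :
      Yields E σ (.pow .exponent HyperAut.alphabetSize e) (s ^ j) :=
    .pow (by omega) h.alphabetSize he (by omega) (pow_le_of_le_pow (by omega) hj (by omega))
  have hle : letter s k k' (σ.r .copy) (finFunctionFinEquiv v) ≤ E.Z := by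
    have hlt := (finFunctionFinEquiv (v ∘ finFunctionFinEquiv.symm ⟨_, hi⟩)).isLt
    rw [← letter_eq] at hlt
    exact hlt.le.trans (by omega)
  refine .sum (h.arityB σ) (by omega) (fun j hj => ?_) hle
  have hk : 0 < k := Nat.pos_of_ne_zero fun hk => by simp [hk, show k' ≠ 0 by omega] at hi
  have hletter := Yields.var (E := E) (σ := σ.set .component j) .letter
  have hcopy := Yields.var (E := E) (σ := σ.set .component j) .copy
  have hcomponent := Yields.var (E := E) (σ := σ.set .component j) .component
  simp only [Store.set, Function.update_self, ne_eq, reduceCtorEq, not_false_eq_true,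
    Function.update_of_ne, hv] at hletter hcopy hcomponent
  refine ((hletter.div (power ((hcopy.div ?_).mod (h.arityA _)) (Nat.mod_lt _ hk).le)).mod
    (h.alphabetSize _)).mul ?_
  · exact .pow (by omega) h.arityA hcomponent (by omega)
      (pow_le_of_le_pow (by omega) hj.le (by omega))
  · exact .pow (by omega) h.alphabetSize hcomponent (by omega)
      (pow_le_of_le_pow (by omega) hj.le (by omega))

theorem badCount (h : Locates E O a b A B) {x : ProdState k k' n n'} (hx : Reads E σ d w x) :
    ∃ m, Yields E σ (O.badCount d) m ∧ (m ≠ 0 ↔ ProdBad B x) := by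
  have := h.bound
  have accepts (i : ℕ) (hi : i < k ^ k') := Yields.ite (P := digit x i < n')
    ((h.sizeB _).sub (hx.copies i hi)) Nat.sub_ne_zero_iff_lt.symm
    (fun _ => .input (((h.posB _).add (yields_ofNat 2)).add (hx.copies i hi)))
    fun _ => yields_ofNat 0
  obtain ⟨m, -, hm, hiff⟩ := Yields.exists_count (h.copyCount σ) (by omega)
    fun i hi => ⟨_, accepts i hi, Iff.rfl⟩
  exact ⟨m, hm, hiff.trans (by
    simp [prodBad_iff_exists_digit h.encodesB, -List.getD_eq_getElem?_getD])⟩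

theorem copyStep (h : Locates E O a b A B) {x : ProdState k k' n n'} {v : Fin k → Fin s}
    (hi : σ.r .copy < k ^ k') (hd : Yields E σ d (digit x (σ.r .copy)))
    (hv : σ.r .letter = finFunctionFinEquiv v) :
    Yields E σ (O.copyStep d) (digit (prodStep A B x v) (σ.r .copy)) := by
  have := h.bound
  rw [digit_prodStep_of_lt h.encodesB x v hi]
  have hpow : Yields E σ (.pow .exponent HyperAut.alphabetSize O.arityB) (s ^ k') :=
    .pow (by omega) h.alphabetSize (h.arityB σ) (by omega) (by omega)
  exact .ite ((h.sizeB σ).sub hd) Nat.sub_ne_zero_iff_lt.symm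
    (fun _ => .input (((((h.posB σ).add (yields_ofNat 2)).add (h.sizeB σ)).add
      (hd.mul hpow)).add (h.copyLetter hi hv))) fun _ => hd

theorem watchStep (h : Locates E O a b A B) {x : ProdState k k' n n'} {v : Fin k → Fin s}
    (hw : Yields E σ w (digit x (k ^ k'))) (hv : σ.r .letter = finFunctionFinEquiv v) :
    Yields E σ (O.watchStep w) (digit (prodStep A B x v) (k ^ k')) := by
  rw [digit_prodStep_last h.encodesA x v, ← hv]
  have hpos := (h.posA σ).add (yields_ofNat 2)
  exact .ite ((h.sizeA σ).sub hw) Nat.sub_ne_zero_iff_lt.symm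
    (fun _ => .ite (.input (hpos.add hw)) Iff.rfl (fun _ => (h.sizeA σ).add (yields_ofNat 1))
      fun _ => .input (((hpos.add (h.sizeA σ)).add (hw.mul (h.letterCount σ))).add
        (.var Reg.letter))) fun _ => hw

theorem reads_step (h : Locates E O a b A B) {x : ProdState k k' n n'} {v : Fin k → Fin s}
    (hx : Reads E σ d w x) (hv : σ.r .letter = finFunctionFinEquiv v) :
    Reads E σ (O.copyStep d) (O.watchStep w) (prodStep A B x v) where
  copies i hi := by
    have hstep := h.copyStep (σ := σ.set .copy i) (x := x) (v := v) (d := d)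
    simp only [Store.set, Function.update_self] at hstep
    exact hstep hi (hx.copies i hi) (by simpa using hv)
  watch := h.watchStep hx.watch hv

theorem reads_start (h : Locates E O a b A B) (σ : Store Reg) :
    Reads E σ (.input (O.posB + 1)) (.input (O.posA + 1)) (prodStart A B) where
  copies i hi := by
    rw [digit_prodStart_of_lt h.encodesB hi]
    exact .input ((h.posB _).add (yields_ofNat 1))
  watch := by
    rw [digit_prodStart_last h.encodesA]
    exact .input ((h.posA _).add (yields_ofNat 1))

end Locates

end Product

/-! ### The deterministic program -/

section Table

variable {s k k' n n' a b V t : ℕ} {E : Env} {O : Operands} {A : DetAut (Fin k → Fin s) n}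
  {B : DetAut (Fin k' → Fin s) n'} {σ : Store Reg} {d w e r : Expr Reg}
  {P : ProdState k k' n n' → Prop} {x : ProdState k k' n n'}

namespace Operands

variable (O : Operands)

/-- The powers of the base of `prodCode`. -/
def basePow (e : Expr Reg) : Expr Reg := .pow .exponent (O.sizeB + 1) e

/-- The number of product states. -/
def stateCount : Expr Reg := (O.sizeA + 2) * O.basePow O.copyCount

/-- The number of the product state with the given digits, see `Reads`. -/
def encode (d w : Expr Reg) : Expr Reg :=
  .sum .copy O.copyCount (d * O.basePow (.var .copy)) + w * O.basePow O.copyCount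

/-- The state of the current copy in the product state with the number in the register `state`. -/
def codeDigit : Expr Reg := .var .state / O.basePow (.var .copy) % (O.sizeB + 1)

/-- The first component of the product state with the number in the register `state`. -/
def codeWatch : Expr Reg := .var .state / O.basePow O.copyCount

/-- The heap is a table with one column for each product state. This is the entry in row `r` and
column `e`. -/
def entry (r e : Expr Reg) : Expr Reg := r * O.stateCount + e

/-- The loop that assigns `e` to the entry of each product state in row `r`. -/
def fillRow (r e : Expr Reg) : Stm Reg :=
  .for .state O.stateCount (.store (O.entry r (.var .state)) e)

/-- Whether some `ProdRel`-successor of the current product state has a nonzero entry in the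
current row. -/
def successorCount : Expr Reg :=
  .ite (O.badCount O.codeDigit) 0 (.count .letter O.letterCount
    (.heap (O.entry (.var .row) (O.encode (O.copyStep O.codeDigit) (O.watchStep O.codeWatch)))))

/-- Computes from the row `0` as many rows as there are product states. Row `i` marks the states
from which a walk of length `i` leads to a state that is marked in row `0`. -/
def sweep : Stm Reg := .for .row O.stateCount (O.fillRow (.var .row + 1) O.successorCount)

/-- Sets `result` to `0` if there is a counterexample, found by `counterexample_iff_exists_walk`
from the end of the second walk backwards. -/
def explore : Stm Reg :=
  O.fillRow 0 1 ;; O.sweep ;;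
  O.fillRow 0 (.ite (O.codeWatch - O.sizeA)
    (.ite (.heap (O.entry O.stateCount (.var .state))) 1 0) 0) ;;
  O.sweep ;;
  .result ≔ .ite (.heap (O.entry O.stateCount
    (O.encode (.input (O.posB + 1)) (.input (O.posA + 1))))) 0 (.var .result)

end Operands

/-- The nonzero entries in row `t` of the table in `σ` are those of the states with property `P`. -/
def Marks (σ : Store Reg) (t : ℕ) (P : ProdState k k' n n' → Prop) : Prop :=
  ∀ x, σ.h (t * (prodSize k k' n n') + prodCode x) ≠ 0 ↔ P x

/-- The stores differ at most in the register `state` and, in a table with `V` columns, in the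
row `t`. -/
structure AgreeOffRow (V t : ℕ) (σ σ' : Store Reg) : Prop where
  reg : ∀ x ≠ .state, σ'.r x = σ.r x
  heap : ∀ u ≠ t, ∀ i < V, σ'.h (u * V + i) = σ.h (u * V + i)

/-- The environment leaves room for a table with `V` rows below row `0` and as many columns. -/
structure FitsTable (E : Env) (V : ℕ) : Prop where
  value : V ≤ E.Z
  round : V ≤ E.T
  size : (V + 1) * V ≤ E.H

theorem FitsTable.entry_lt (hE : FitsTable E V) {i : ℕ} (ht : t ≤ V) (hi : i < V) :
    t * V + i < E.H :=
  calc t * V + i < (t + 1) * V := by rw [add_mul]; omega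
    _ ≤ (V + 1) * V := Nat.mul_le_mul_right V (by omega)
    _ ≤ E.H := hE.size

theorem AgreeOffRow.set {σ' : Store Reg} (h : AgreeOffRow V t σ σ') (i : ℕ) :
    AgreeOffRow V t σ (σ'.set .state i) where
  reg x hx := (Function.update_of_ne hx _ _).trans (h.reg x hx)
  heap := h.heap

theorem AgreeOffRow.put {σ' : Store Reg} (h : AgreeOffRow V t σ σ') {i : ℕ} (hi : i < V) (m : ℕ) :
    AgreeOffRow V t σ (σ'.put (t * V + i) m) where
  reg := h.reg
  heap u hu j hj := by
    have hne : u * V + j ≠ t * V + i := fun heq => hu <| by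
      simpa [Nat.mul_add_div, mul_comm _ V, (Nat.zero_le i).trans_lt hi, Nat.div_eq_of_lt, hi, hj]
        using congrArg (· / V) heq
    exact (Function.update_of_ne hne _ _).trans (h.heap u hu j hj)

theorem Marks.of_agree (h : Marks σ t P) {u : ℕ} {σ' : Store Reg}
    (hσ : AgreeOffRow (prodSize k k' n n') u σ σ') (hu : t ≠ u) : Marks σ' t P := fun x => by
  rw [hσ.heap t hu _ (prodCode x).isLt]
  exact h x

namespace Locates

theorem basePow (h : Locates E O a b A B) (hE : FitsTable E (prodSize k k' n n')) {i : ℕ}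
    (he : Yields E σ e i) (hi : i ≤ k ^ k') : Yields E σ (O.basePow e) ((n' + 1) ^ i) := by
  have := h.bound
  refine .pow (by omega) (fun σ => (h.sizeB σ).add (yields_ofNat 1)) he (by omega) ?_
  calc (n' + 1) ^ i ≤ (n' + 1) ^ k ^ k' := Nat.pow_le_pow_right (by omega) hi
    _ ≤ prodSize k k' n n' := Nat.le_mul_of_pos_left _ (by omega)
    _ ≤ E.Z := hE.value

theorem stateCount (h : Locates E O a b A B) (hE : FitsTable E (prodSize k k' n n'))
    (σ : Store Reg) : Yields E σ O.stateCount (prodSize k k' n n') :=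
  ((h.sizeA σ).add (yields_ofNat 2)).mul (h.basePow hE (h.copyCount σ) le_rfl)

theorem entry (h : Locates E O a b A B) (hE : FitsTable E (prodSize k k' n n')) {i : ℕ}
    (hr : Yields E σ r t) (he : Yields E σ e i) :
    Yields E σ (O.entry r e) (t * (prodSize k k' n n') + i) :=
  (hr.mul (h.stateCount hE σ)).add he

theorem encode (h : Locates E O a b A B) (hE : FitsTable E (prodSize k k' n n'))
    (hx : Reads E σ d w x) : Yields E σ (O.encode d w) (prodCode x) := by
  have hcopies := h.bound
  have hsum := (val_prodCode_eq_sum x).symm.trans_le ((prodCode x).isLt.le.trans hE.value)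
  rw [val_prodCode_eq_sum]
  refine (Yields.sum (h.copyCount σ) (by omega) (fun i hi => (hx.copies i hi).mul ?_)
    (by omega)).add (hx.watch.mul (h.basePow hE (h.copyCount σ) le_rfl))
  have hcopy := Yields.var (E := E) (σ := σ.set .copy i) .copy
  simp only [Store.set, Function.update_self] at hcopy
  exact h.basePow hE hcopy hi.le

theorem reads_code (h : Locates E O a b A B) (hE : FitsTable E (prodSize k k' n n'))
    (hx : σ.r .state = prodCode x) : Reads E σ O.codeDigit O.codeWatch x where
  copies i hi := by
    have hcopy := Yields.var (E := E) (σ := σ.set .copy i) .copy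
    have hstate := Yields.var (E := E) (σ := σ.set .copy i) .state
    simp only [Store.set, Function.update_self, ne_eq, reduceCtorEq, not_false_eq_true,
      Function.update_of_ne, hx] at hcopy hstate
    rw [← prodCode_div_mod_eq_digit x hi]
    exact (hstate.div (h.basePow hE hcopy hi.le)).mod ((h.sizeB _).add (yields_ofNat 1))
  watch := by
    rw [← prodCode_div_eq_digit, ← hx]
    exact (Yields.var Reg.state).div (h.basePow hE (h.copyCount σ) le_rfl)

theorem successorCount (h : Locates E O a b A B)
    (hE : FitsTable E (prodSize k k' n n')) (hx : σ.r .state = prodCode x)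
    (hP : Marks σ (σ.r .row) P) :
    ∃ m ≤ E.Z, Yields E σ O.successorCount m ∧ (m ≠ 0 ↔ ∃ y, ProdRel A B x y ∧ P y) := by
  have := h.bound
  obtain ⟨l, hl, hbad⟩ := h.badCount (h.reads_code hE hx)
  obtain ⟨m, hm, hcount, hiff⟩ := Yields.exists_count (x := Reg.letter)
    (c := .heap (O.entry (.var .row)
      (O.encode (O.copyStep O.codeDigit) (O.watchStep O.codeWatch))))
    (P := fun i => ∃ v, finFunctionFinEquiv v = i ∧ P (prodStep A B x v))
    (h.letterCount σ) (by omega) fun i hi => by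
      obtain ⟨v, hv⟩ := finFunctionFinEquiv.surjective ⟨i, hi⟩
      obtain rfl : finFunctionFinEquiv v = i := congrArg Fin.val hv
      have hx' := h.reads_code hE (σ := σ.set .letter (finFunctionFinEquiv v)) hx
      have hy := h.reads_step (v := v) hx' (by simp only [Store.set, Function.update_self])
      refine ⟨_, .heap (h.entry hE (.var Reg.row) (h.encode hE hy)),
        (hP _).trans ⟨fun hy => ⟨v, rfl, hy⟩, fun ⟨u, hu, hy⟩ =>
          finFunctionFinEquiv.injective (Fin.ext hu) ▸ hy⟩⟩
  classical
  refine ⟨_, ?_, .ite hl hbad.symm (fun _ => yields_ofNat 0) fun _ => hcount, ?_⟩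
  · split_ifs <;> omega
  · by_cases hx : ProdBad B x
    · simp [hx, ProdRel]
    · simp only [hx, if_false, hiff, ProdRel]
      exact ⟨fun ⟨_, _, v, _, hv⟩ => ⟨_, ⟨not_false, v, rfl⟩, hv⟩,
        fun ⟨_, ⟨_, v, rfl⟩, hv⟩ => ⟨_, (finFunctionFinEquiv v).isLt, v, rfl, hv⟩⟩

theorem wp_fillRow (h : Locates E O a b A B) (hE : FitsTable E (prodSize k k' n n'))
    (ht : t ≤ prodSize k k' n n')
    (hr : ∀ σ', AgreeOffRow (prodSize k k' n n') t σ σ' → Yields E σ' r t)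
    (he : ∀ σ' x, AgreeOffRow (prodSize k k' n n') t σ σ' → σ'.r .state = prodCode x →
      ∃ m ≤ E.Z, Yields E σ' e m ∧ (m ≠ 0 ↔ P x)) :
    wp E (O.fillRow r e) σ fun σ' =>
      AgreeOffRow (prodSize k k' n n') t σ σ' ∧ Marks σ' t P := by
  refine wp_for (fun j σ' => AgreeOffRow (prodSize k k' n n') t σ σ' ∧
      ∀ x : ProdState k k' n n', prodCode x < j →
        (σ'.h (t * (prodSize k k' n n') + prodCode x) ≠ 0 ↔ P x))
    (h.stateCount hE) hE.value hE.round ?_ ?_ ?_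
  · have hrefl : AgreeOffRow (prodSize k k' n n') t σ σ := ⟨fun _ _ => rfl, fun _ _ _ _ => rfl⟩
    exact ⟨hrefl.set 0, fun x hx => absurd hx (Nat.not_lt_zero _)⟩
  · rintro i σ' hi hx ⟨hσ, hdone⟩
    obtain ⟨x, hi'⟩ := prodCode.surjective ⟨i, hi⟩
    obtain rfl : prodCode x = i := congrArg Fin.val hi'
    obtain ⟨m, hm, hem, hiff⟩ := he σ' x hσ hx
    refine wp_store (h.entry hE (hr σ' hσ) (.var Reg.state)) hem (hx ▸ hE.entry_lt ht hi) hm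
      ⟨hx, (hx ▸ hσ.put hi m).set _, fun y hy => ?_⟩
    simp only [Store.set, Store.put, hx]
    rcases (Nat.lt_succ_iff.1 hy).lt_or_eq with hlt | heq
    · rw [Function.update_of_ne (by omega)]
      exact hdone y hlt
    · rw [heq, Function.update_self, hiff, prodCode.injective (Fin.ext heq)]
  · exact fun σ' ⟨hσ, hdone⟩ => ⟨hσ, fun x => hdone x (prodCode x).isLt⟩

theorem wp_sweep (h : Locates E O a b A B) (hE : FitsTable E (prodSize k k' n n'))
    (hP : Marks σ 0 P) :
    wp E O.sweep σ fun σ' => σ'.r .result = σ.r .result ∧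
      Marks σ' (prodSize k k' n n') fun x =>
        ∃ y, Walk (ProdRel A B) (prodSize k k' n n') x y ∧ P y := by
  refine wp_for (fun i σ' => σ'.r .result = σ.r .result ∧ Marks σ' i fun x =>
    ∃ y, Walk (ProdRel A B) i x y ∧ P y) (h.stateCount hE) hE.value hE.round ?_ ?_ fun _ => id
  · exact ⟨rfl, fun x => (hP x).trans ⟨fun hx => ⟨x, rfl, hx⟩, fun ⟨_, hy, hP⟩ => hy ▸ hP⟩⟩
  · rintro i σ hi rfl ⟨hresult, hmarks⟩
    refine wp_mono (h.wp_fillRow hE (t := σ.r .row + 1)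
      (P := fun x => ∃ y, ProdRel A B x y ∧ ∃ z, Walk (ProdRel A B) (σ.r .row) y z ∧ P z)
      hi ?_ ?_) ?_
    · exact fun σ' hσ => hσ.reg .row (by simp) ▸ (Yields.var Reg.row).add (yields_ofNat 1)
    · intro σ' x hσ hx
      have := hmarks.of_agree hσ (by omega)
      exact h.successorCount hE hx (hσ.reg .row (by simp) ▸ this)
    · rintro σ' ⟨hσ, hmarks⟩
      exact ⟨hσ.reg .row (by simp), (hσ.reg .result (by simp)).trans hresult, fun x =>
        (hmarks x).trans ⟨fun ⟨y, hxy, z, hyz, hz⟩ => ⟨z, ⟨y, hxy, hyz⟩, hz⟩,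
          fun ⟨z, ⟨y, hxy, hyz⟩, hz⟩ => ⟨y, hxy, z, hyz, hz⟩⟩⟩

open Classical in
theorem wp_explore (h : Locates E O a b A B) (hE : FitsTable E (prodSize k k' n n'))
    (hσ : σ.r .result ≤ E.Z) :
    wp E O.explore σ fun σ' => σ'.r .result =
      if Counterexample A.toNFA.accepts B.toNFA.accepts then 0 else σ.r .result := by
  have := h.bound
  refine wp_seq (h.wp_fillRow hE (P := fun _ => True) (Nat.zero_le _) (fun _ _ => yields_ofNat 0)
    fun _ _ _ _ => ⟨1, by omega, yields_ofNat 1, by simp⟩) fun σ₁ ⟨hσ₁, hall⟩ =>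
    wp_seq (h.wp_sweep hE hall) fun σ₂ ⟨hσ₂, htail⟩ =>
    wp_seq (h.wp_fillRow hE
      (P := fun y => y.1 = none ∧ ∃ z, Walk (ProdRel A B) (prodSize k k' n n') y z)
      (Nat.zero_le _) (fun _ _ => yields_ofNat 0) ?_) fun σ₃ ⟨hσ₃, hmask⟩ =>
    wp_seq (h.wp_sweep hE hmask) fun σ₄ ⟨hσ₄, hwalks⟩ => ?_
  · intro σ' x hσ hx
    have hwatch := (h.reads_code hE hx).watch.sub (h.sizeA σ')
    have hrow := (htail.of_agree hσ (by positivity : prodSize k k' n n' ≠ 0)) x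
    rw [← hx] at hrow
    have hmark := Yields.ite (.heap (h.entry hE (h.stateCount hE σ') (.var Reg.state)))
      hrow.symm (fun _ => yields_ofNat 1) fun _ => yields_ofNat 0
    refine ⟨_, ?_, .ite hwatch (fst_eq_none_iff x) (fun _ => hmark) fun _ => yields_ofNat 0, ?_⟩
    · split_ifs <;> omega
    · simp
  · have hresult : σ₄.r .result = σ.r .result := by
      rw [hσ₄, hσ₃.reg .result (by simp), hσ₂, hσ₁.reg .result (by simp)]
    have hcell := Yields.heap (h.entry hE (h.stateCount hE σ₄) (h.encode hE (h.reads_start σ₄)))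
    have hiff := (hwalks (prodStart A B)).trans (exists_congr fun y => by
      rw [← exists_and_left, ← exists_and_left])
    rw [← counterexample_iff_exists_walk le_rfl] at hiff
    refine wp_assign (.ite hcell hiff.symm (fun _ => yields_ofNat 0) fun _ => .var Reg.result) ?_ ?_
    · split_ifs <;> omega
    · simp [Store.set, hresult]

end Locates

end Table

/-! ### The nondeterministic program -/

section Search

namespace Operands

variable (O : Operands)

/-- Replaces the product state whose digits are in the heap cells `0, …, k ^ k'`. Here `d` is the
new state of the current copy, and `w` the new first component. -/
def setState (d w : Expr Reg) : Stm Reg :=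
  .for .copy O.copyCount (.store (.var .copy) d) ;; .store O.copyCount w

/-- The base of the counter, which has `k ^ k' + 2` digits in the heap cells from `k ^ k' + 1`. -/
def counterBase : Expr Reg := O.sizeA + O.sizeB + 2

/-- The heap cell with the digit `i` of the counter. -/
def counterCell (i : Expr Reg) : Expr Reg := O.copyCount + 1 + i

/-- Adds `carry` to the current digit of the counter, and leaves the new carry. -/
def addCarry : Stm Reg :=
  .carry ≔ .heap (O.counterCell (.var .copy)) + .var .carry ;;
  .store (O.counterCell (.var .copy)) (.var .carry % O.counterBase) ;;
  .carry ≔ .var .carry / O.counterBase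

/-- Increments the counter. -/
def increment : Stm Reg := .carry ≔ 1 ;; .for .copy (O.copyCount + 2) O.addCarry

/-- Guesses a transition of the product. Sets `result` to `1` if it violates `ProdRel`. -/
def guessStep : Stm Reg :=
  .guess .letter (O.letterCount - 1) ;;
  .result ≔ .ite (O.badCount (.heap (.var .copy))) 1 (.var .result) ;;
  O.setState (O.copyStep (.heap (.var .copy))) (O.watchStep (.heap O.copyCount)) ;;
  O.increment

/-- Guesses transitions until the leading digit of the counter is not zero. -/
def walk : Stm Reg := .loop (1 - .heap (O.counterCell (O.copyCount + 1))) O.guessStep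

/-- Guesses the two walks of `counterexample_iff_exists_walk`. Sets `result` to `1` if they do not
form a counterexample. -/
def search : Stm Reg :=
  O.setState (.input (O.posB + 1)) (.input (O.posA + 1)) ;;
  O.walk ;;
  .result ≔ .ite (.heap O.copyCount - O.sizeA) (.var .result) 1 ;;
  .store (O.counterCell (O.copyCount + 1)) 0 ;;
  O.walk

end Operands

variable {s k k' n n' a b c : ℕ} {E : Env} {O : Operands} {A : DetAut (Fin k → Fin s) n}
  {B : DetAut (Fin k' → Fin s) n'} {σ : Store Reg} {d w : Expr Reg} {x y : ProdState k k' n n'}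
  {J J₁ J₂ : ℕ → ProdState k k' n n' → ℕ → Prop} {Q : Store Reg → Prop}

/-- The number of steps of each of the two walks. -/
abbrev searchLength (k k' n n' : ℕ) : ℕ := (n + n' + 2) ^ (k ^ k' + 1)

/-- The environment leaves room for a product state and a counter, and time for a walk. -/
structure FitsCounter (E : Env) (k k' n n' : ℕ) : Prop where
  round : searchLength k k' n n' ≤ E.T
  size : 2 * k ^ k' + 3 ≤ E.H

/-- The heap contains the digits of the state `x` and of the counter `c`. -/
structure Contains (σ : Store Reg) (x : ProdState k k' n n') (c : ℕ) : Prop where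
  state : ∀ i ≤ k ^ k', σ.h i = digit x i
  counter : ∀ i < k ^ k' + 2, σ.h (k ^ k' + 1 + i) = c / (n + n' + 2) ^ i % (n + n' + 2)

open Classical in
/-- One step of the search preserves `J`, for all choices if they are demonic and for some choice if
they are angelic. The arguments of `J` are the number of steps, the product state and `result`. -/
def Advances (E : Env) (A : DetAut (Fin k → Fin s) n) (B : DetAut (Fin k' → Fin s) n')
    (J : ℕ → ProdState k k' n n' → ℕ → Prop) : Prop :=
  ∀ t x r, t < searchLength k k' n n' → J t x r →
    bif E.dem then ∀ v, J (t + 1) (prodStep A B x v) (if ProdBad B x then 1 else r)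
    else ∃ v, J (t + 1) (prodStep A B x v) (if ProdBad B x then 1 else r)

theorem prodSize_le_searchLength : prodSize k k' n n' ≤ searchLength k k' n n' := by
  rw [searchLength, pow_succ']
  exact Nat.mul_le_mul (by omega) (Nat.pow_le_pow_left (by omega) _)

-- The carry into the digit `i` of `c + 1` is the difference of the quotients by `b ^ i`.
theorem digit_add_carry {b : ℕ} (hb : 0 < b) (c i : ℕ) :
    (c / b ^ i % b + ((c + 1) / b ^ i - c / b ^ i)) % b = (c + 1) / b ^ i % b ∧
    (c / b ^ i % b + ((c + 1) / b ^ i - c / b ^ i)) / b =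
      (c + 1) / b ^ (i + 1) - c / b ^ (i + 1) ∧
    c / b ^ i % b + ((c + 1) / b ^ i - c / b ^ i) ≤ b := by
  have hmono : c / b ^ i ≤ (c + 1) / b ^ i := Nat.div_le_div_right c.le_succ
  have hle : (c + 1) / b ^ i ≤ c / b ^ i + 1 := by
    rw [Nat.succ_div]
    split_ifs <;> omega
  rw [pow_succ, ← Nat.div_div_eq_div_mul, ← Nat.div_div_eq_div_mul]
  generalize c / b ^ i = q at *
  generalize (c + 1) / b ^ i = q' at *
  have hlt := Nat.mod_lt q hb
  have hq' : q' = q % b + (q' - q) + b * (q / b) := by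
    have := Nat.mod_add_div q b
    omega
  refine ⟨?_, ?_, by omega⟩
  · conv_rhs => rw [hq', Nat.add_mul_mod_self_left]
  · conv_rhs => rw [hq', Nat.add_mul_div_left _ _ hb, Nat.add_sub_cancel]

namespace Locates

theorem wp_setState (h : Locates E O a b A B) (hE : FitsCounter E k k' n n')
    (hd : ∀ σ', (∀ x ≠ .copy, σ'.r x = σ.r x) → σ'.r .copy < k ^ k' →
      (∀ i ≥ σ'.r .copy, σ'.h i = σ.h i) → Yields E σ' d (digit y (σ'.r .copy)))
    (hw : ∀ σ', (∀ x ≠ .copy, σ'.r x = σ.r x) → (∀ i ≥ k ^ k', σ'.h i = σ.h i) →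
      Yields E σ' w (digit y (k ^ k'))) :
    wp E (O.setState d w) σ fun σ' => (∀ x ≠ .copy, σ'.r x = σ.r x) ∧
      (∀ i ≤ k ^ k', σ'.h i = digit y i) ∧ ∀ i > k ^ k', σ'.h i = σ.h i := by
  have hZ := h.bound
  have hH := hE.size
  have hT : k ^ k' ≤ E.T := ((Nat.lt_succ_self _).trans
    (Nat.lt_pow_self (by omega : 1 < n + n' + 2))).le.trans hE.round
  refine wp_seq (wp_for (fun j σ' => (∀ x ≠ .copy, σ'.r x = σ.r x) ∧
    (∀ i < j, σ'.h i = digit y i) ∧ ∀ i ≥ j, σ'.h i = σ.h i) h.copyCount (by omega) hT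
    ⟨fun x (hx : x ≠ .copy) => Function.update_of_ne hx _ _,
      fun _ hi => absurd hi (Nat.not_lt_zero _), fun _ _ => rfl⟩ ?_ fun _ => id) ?_
  · rintro _ σ' hi rfl ⟨hreg, hdone, hrest⟩
    refine wp_store (.var Reg.copy) (hd σ' hreg hi hrest) (by omega)
      ((digit_lt y _).le.trans (by omega)) ⟨rfl,
        fun x hx => (Function.update_of_ne hx _ _).trans (hreg x hx), fun i hi => ?_,
        fun i hi => ?_⟩
    · rcases (Nat.lt_succ_iff.1 hi).lt_or_eq with hlt | rfl
      · exact (Function.update_of_ne hlt.ne _ _).trans (hdone i hlt)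
      · exact Function.update_self _ _ _
    · exact (Function.update_of_ne (by omega) _ _).trans (hrest i (by omega))
  · rintro σ' ⟨hreg, hdone, hrest⟩
    refine wp_store (h.copyCount σ') (hw σ' hreg hrest) (by omega)
      ((digit_lt y _).le.trans (by omega)) ⟨hreg, fun i hi => ?_, fun i hi => ?_⟩
    · rcases hi.lt_or_eq with hlt | rfl
      · exact (Function.update_of_ne hlt.ne _ _).trans (hdone i hlt)
      · exact Function.update_self _ _ _
    · exact (Function.update_of_ne hi.ne' _ _).trans (hrest i hi.le)

theorem counterCell (h : Locates E O a b A B) {e : Expr Reg} {i : ℕ} (he : Yields E σ e i) :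
    Yields E σ (O.counterCell e) (k ^ k' + 1 + i) :=
  ((h.copyCount σ).add (yields_ofNat 1)).add he

theorem wp_addCarry (h : Locates E O a b A B) (hE : FitsCounter E k k' n n') {S : ℕ}
    (hi : σ.r .copy < k ^ k' + 2) (hS : σ.h (k ^ k' + 1 + σ.r .copy) + σ.r .carry = S)
    (hle : S ≤ E.Z) (hQ : Q ((((σ.set .carry S).put (k ^ k' + 1 + σ.r .copy)
      (S % (n + n' + 2)))).set .carry (S / (n + n' + 2)))) :
    wp E O.addCarry σ Q := by
  have hH := hE.size
  have base (σ : Store Reg) : Yields E σ O.counterBase (n + n' + 2) :=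
    ((h.sizeA σ).add (h.sizeB σ)).add (yields_ofNat 2)
  subst hS
  refine wp_seq (wp_assign ((Yields.heap (h.counterCell (.var .copy))).add (.var .carry)) hle
    (Eq.refl _)) ?_
  rintro _ rfl
  refine wp_seq (wp_store (h.counterCell (.var Reg.copy)) ((Yields.var Reg.carry).mod (base _))
    ?_ ?_ (Eq.refl _)) ?_
  · simp only [Store.set, ne_eq, reduceCtorEq, not_false_eq_true, Function.update_of_ne]
    omega
  · simp only [Store.set, Function.update_self]
    exact (Nat.mod_le _ _).trans hle
  rintro _ rfl
  refine wp_assign ((Yields.var Reg.carry).div (base _)) ?_ ?_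
  · simp only [Store.set, Store.put, Function.update_self]
    exact (Nat.div_le_self _ _).trans hle
  · simpa [Store.set, Store.put] using hQ

theorem wp_increment (h : Locates E O a b A B) (hE : FitsCounter E k k' n n')
    (hσ : Contains σ x c) :
    wp E O.increment σ fun σ' => σ'.r .result = σ.r .result ∧ Contains σ' x (c + 1) := by
  have hZ := h.bound
  have hT : k ^ k' + 2 ≤ E.T := (Nat.lt_pow_self (by omega : 1 < n + n' + 2)).trans_le hE.round
  refine wp_seq (wp_assign (yields_ofNat 1) (by omega) (Eq.refl (σ.set .carry 1))) ?_
  rintro _ rfl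
  refine wp_for (fun i σ' => σ'.r .result = σ.r .result ∧
      σ'.r .carry = (c + 1) / (n + n' + 2) ^ i - c / (n + n' + 2) ^ i ∧
      (∀ j ≤ k ^ k', σ'.h j = digit x j) ∧ ∀ j < k ^ k' + 2, σ'.h (k ^ k' + 1 + j) =
        (if j < i then c + 1 else c) / (n + n' + 2) ^ j % (n + n' + 2))
    (fun σ => (h.copyCount σ).add (yields_ofNat 2)) (by omega) hT
    ⟨rfl, by simp [Store.set], hσ.state, hσ.counter⟩ ?_
    fun σ' ⟨hr, _, hs, hc⟩ => ⟨hr, hs, fun i hi => (hc i hi).trans (by rw [if_pos hi])⟩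
  rintro i σ' hi rfl ⟨hresult, hcarry, hstate, hcounter⟩
  have hcell := hcounter _ hi
  rw [if_neg (lt_irrefl _)] at hcell
  obtain ⟨hdigit, hcarry', hle⟩ := digit_add_carry (b := n + n' + 2) (by omega) c (σ'.r .copy)
  refine h.wp_addCarry hE hi (congrArg₂ (· + ·) hcell hcarry) (by omega)
    ⟨by simp [Store.set, Store.put], by simpa [Store.set, Store.put] using hresult, ?_, ?_, ?_⟩
  · simpa [Store.set, Store.put] using hcarry'
  · intro j hj
    exact (Function.update_of_ne (by omega) _ _).trans (hstate j hj)
  · intro j hj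
    simp only [Store.set, Store.put]
    rcases eq_or_ne j (σ'.r .copy) with rfl | hne
    · rw [Function.update_self, if_pos (Nat.lt_succ_self _), hdigit]
    · rw [Function.update_of_ne (by omega), hcounter j hj]
      congr 3
      simp only [eq_iff_iff]
      omega

theorem wp_guess_letter (h : Locates E O a b A B) (hs : 0 < s ^ k) {K : (Fin k → Fin s) → Prop}
    (hK : bif E.dem then ∀ v, K v else ∃ v, K v)
    (hQ : ∀ v, K v → Q (σ.set .letter (finFunctionFinEquiv v))) :
    wp E (.guess .letter (O.letterCount - 1)) σ Q := by
  have hZ := h.bound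
  refine ⟨_, (h.letterCount σ).sub (yields_ofNat 1), by omega, ?_⟩
  cases hdem : E.dem with
  | true =>
    rw [hdem] at hK
    intro i hi
    obtain ⟨v, hv⟩ := finFunctionFinEquiv.surjective (⟨i, by omega⟩ : Fin (s ^ k))
    have hQv := hQ v (hK v)
    rwa [hv] at hQv
  | false =>
    rw [hdem] at hK
    obtain ⟨v, hv⟩ := hK
    exact ⟨_, Nat.le_sub_one_of_lt (Fin.isLt _), hQ v hv⟩

theorem reads_heap (h : Locates E O a b A B) (hσ : Contains σ x c) :
    Reads E σ (.heap (.var .copy)) (.heap O.copyCount) x where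
  copies i hi := by
    have hcell := Yields.heap (E := E) (.var (σ := σ.set .copy i) .copy)
    simp only [Store.set, Function.update_self, hσ.state i hi.le] at hcell
    exact hcell
  watch := hσ.state _ le_rfl ▸ .heap (h.copyCount σ)

open Classical in
theorem wp_guessStep (h : Locates E O a b A B) (hE : FitsCounter E k k' n n') (hs : 0 < s ^ k)
    (hσ : Contains σ x c) (hr : σ.r .result ≤ 1) {K : ProdState k k' n n' → ℕ → Prop}
    (hK : bif E.dem then ∀ v, K (prodStep A B x v) (if ProdBad B x then 1 else σ.r .result)
      else ∃ v, K (prodStep A B x v) (if ProdBad B x then 1 else σ.r .result)) :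
    wp E O.guessStep σ fun σ' =>
      ∃ y, Contains σ' y (c + 1) ∧ σ'.r .result ≤ 1 ∧ K y (σ'.r .result) := by
  have hZ := h.bound
  refine wp_seq (P := fun σ' => ∃ v, K (prodStep A B x v)
    (if ProdBad B x then 1 else σ.r .result) ∧ σ' = σ.set .letter (finFunctionFinEquiv v))
    (h.wp_guess_letter hs hK fun v hv => ⟨v, hv, rfl⟩) ?_
  rintro _ ⟨v, hv, rfl⟩
  obtain ⟨m, hm, hbad⟩ := h.badCount (h.reads_heap (σ := σ.set .letter (finFunctionFinEquiv v))
    ⟨hσ.state, hσ.counter⟩)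
  have hr' : (if ProdBad B x then 1 else σ.r .result) ≤ 1 := by split_ifs <;> omega
  refine wp_seq (wp_assign (.ite hm hbad.symm (fun _ => yields_ofNat 1) fun _ => .var Reg.result)
    (hr'.trans (by omega)) (Eq.refl _)) ?_
  rintro _ rfl
  refine wp_seq (h.wp_setState hE (y := prodStep A B x v) ?_ ?_) ?_
  · intro σ' hreg hi hheap
    refine h.copyStep hi ?_ ((hreg .letter (by simp)).trans (by simp [Store.set]))
    rw [← hσ.state _ hi.le]
    exact hheap _ le_rfl ▸ .heap (.var Reg.copy)
  · intro σ' hreg hheap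
    refine h.watchStep ?_ ((hreg .letter (by simp)).trans (by simp [Store.set]))
    rw [← hσ.state _ le_rfl]
    exact hheap _ le_rfl ▸ .heap (h.copyCount σ')
  · rintro σ₁ ⟨hreg, hstate, hheap⟩
    have hresult := hreg .result (by simp)
    refine wp_mono (h.wp_increment hE ⟨hstate, fun i hi => (hheap _ (by omega)).trans
      (hσ.counter i hi)⟩) fun σ₂ ⟨hσ₂, hcontains⟩ => ⟨_, hcontains, ?_⟩
    rw [hσ₂, hresult]
    simpa [Store.set] using And.intro hr' hv

theorem wp_walk (h : Locates E O a b A B) (hE : FitsCounter E k k' n n') (hs : 0 < s ^ k)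
    (hσ : Contains σ x 0) (hr : σ.r .result ≤ 1) (hJ : J 0 x (σ.r .result))
    (hstep : Advances E A B J) :
    wp E O.walk σ fun σ' => ∃ y, Contains σ' y (searchLength k k' n n') ∧ σ'.r .result ≤ 1 ∧
      J (searchLength k k' n n') y (σ'.r .result) := by
  have top {σ : Store Reg} {x : ProdState k k' n n'} {c : ℕ} (hσ : Contains σ x c) :
      Yields E σ (1 - .heap (O.counterCell (O.copyCount + 1)))
        (1 - c / searchLength k k' n n' % (n + n' + 2)) := by
    have hcell := hσ.counter (k ^ k' + 1) (by omega)
    rw [← hcell]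
    exact (yields_ofNat 1).sub (.heap (h.counterCell ((h.copyCount σ).add (yields_ofNat 1))))
  refine wp_loop_count (searchLength k k' n n')
    (fun t σ => ∃ y, Contains σ y t ∧ σ.r .result ≤ 1 ∧ J t y (σ.r .result)) hE.round
    ⟨x, hσ, hr, hJ⟩ ?_ ?_
  · rintro t σ ht ⟨y, hσ, hr, hJ⟩
    refine ⟨⟨_, ?_, top hσ⟩, h.wp_guessStep hE hs hσ hr (hstep t y _ ht hJ)⟩
    simp [Nat.div_eq_of_lt ht]
  · rintro σ ⟨y, hσ, hr, hJ⟩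
    refine ⟨?_, y, hσ, hr, hJ⟩
    have htop := top hσ
    rwa [Nat.div_self (by positivity), Nat.mod_eq_of_lt (by omega)] at htop

open Classical in
theorem wp_search (h : Locates E O a b A B) (hE : FitsCounter E k k' n n') (hs : 0 < s ^ k)
    (hσ : ∀ i > k ^ k', σ.h i = 0) (hr : σ.r .result ≤ 1)
    (h₁ : J₁ 0 (prodStart A B) (σ.r .result)) (hstep₁ : Advances E A B J₁)
    (h₂ : ∀ x r, J₁ (searchLength k k' n n') x r → J₂ 0 x (if x.1 = none then r else 1))
    (hstep₂ : Advances E A B J₂) :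
    wp E O.search σ fun σ' => ∃ y, J₂ (searchLength k k' n n') y (σ'.r .result) := by
  have hZ := h.bound
  have hH := hE.size
  refine wp_seq (h.wp_setState hE (y := prodStart A B) ?_ ?_) ?_
  · intro σ' _ hi _
    have hcopy := (h.reads_start σ').copies _ hi
    rwa [Store.set_eq_self] at hcopy
  · exact fun σ' _ _ => (h.reads_start σ').watch
  rintro σ₁ ⟨hreg, hstate, hrest⟩
  have hσ₁ : Contains σ₁ (prodStart A B) 0 :=
    ⟨hstate, fun i _ => by rw [hrest _ (by omega), hσ _ (by omega)]; simp⟩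
  have hresult := hreg .result (by simp)
  refine wp_seq (h.wp_walk hE hs hσ₁ (hresult.trans_le hr) (hresult ▸ h₁) hstep₁) ?_
  rintro σ₂ ⟨y, hσ₂, hr₂, hJ₂⟩
  have hwatch := (h.reads_heap hσ₂).watch.sub (h.sizeA σ₂)
  refine wp_seq (wp_assign (.ite hwatch (fst_eq_none_iff y) (fun _ => .var Reg.result)
    fun _ => yields_ofNat 1) ?_ (Eq.refl _)) ?_
  · split_ifs <;> omega
  rintro _ rfl
  refine wp_seq (wp_store (h.counterCell ((h.copyCount _).add (yields_ofNat 1))) (yields_ofNat 0)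
    (by omega) (by omega) (Eq.refl _)) ?_
  rintro _ rfl
  refine wp_mono (h.wp_walk hE hs (x := y) ⟨fun i hi => ?_, fun i hi => ?_⟩ ?_ ?_ hstep₂)
    fun σ' ⟨y, _, _, hy⟩ => ⟨y, hy⟩
  · exact (Function.update_of_ne (by omega) _ _).trans (hσ₂.state i hi)
  · simp only [Store.put, Store.set, Nat.zero_div, Nat.zero_mod]
    rcases eq_or_ne i (k ^ k' + 1) with rfl | hne
    · exact Function.update_self _ _ _
    · rw [Function.update_of_ne (by omega), hσ₂.counter i hi]
      rw [searchLength, Nat.pow_div (by omega) (by omega)]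
      exact Nat.mod_eq_zero_of_dvd (dvd_pow_self _ (by omega))
  · simp only [Store.put, Store.set, Function.update_self]
    split_ifs <;> omega
  · simpa [Store.put, Store.set] using h₂ _ _ hJ₂

theorem wp_search_demonic (h : Locates E O a b A B) (hE : FitsCounter E k k' n n')
    (hdem : E.dem = true) (hs : 0 < s ^ k) (hσ : ∀ i > k ^ k', σ.h i = 0) (hr : σ.r .result ≤ 1) :
    wp E O.search σ fun σ' =>
      σ'.r .result = 0 → Counterexample A.toNFA.accepts B.toNFA.accepts := by
  classical
  have advances {X : ℕ → ProdState k k' n n' → Prop}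
      (hX : ∀ t x y, X t x → ProdRel A B x y → X (t + 1) y) :
      Advances E A B fun t x r => r = 0 → X t x := by
    intro t x r _ hx
    simp only [hdem, cond_true]
    intro v hv
    by_cases hbad : ProdBad B x
    · simp [hbad] at hv
    · exact hX t x _ (hx (by simpa [hbad] using hv)) ⟨hbad, v, rfl⟩
  refine wp_mono (h.wp_search hE hs hσ hr (fun _ => rfl)
    (advances (X := fun t x => Walk (ProdRel A B) t (prodStart A B) x) fun _ _ _ => Walk.snoc)
    (J₂ := fun t z r => r = 0 → ∃ y,
      Walk (ProdRel A B) (searchLength k k' n n') (prodStart A B) y ∧ y.1 = none ∧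
        Walk (ProdRel A B) t y z) (fun x r hx hr => ?_)
    (advances fun _ _ _ ⟨y, hy, hnone, hyx⟩ hxz => ⟨y, hy, hnone, hyx.snoc hxz⟩))
    fun σ' ⟨z, hz⟩ hresult => ?_
  · by_cases hnone : x.1 = none
    · exact ⟨x, hx (by simpa [hnone] using hr), hnone, rfl⟩
    · simp [hnone] at hr
  · obtain ⟨y, hy, hnone, hyz⟩ := hz hresult
    exact (counterexample_iff_exists_walk prodSize_le_searchLength).2 ⟨y, z, hy, hnone, hyz⟩

theorem wp_search_angelic (h : Locates E O a b A B) (hE : FitsCounter E k k' n n')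
    (hdem : E.dem = false) (hs : 0 < s ^ k) (hσ : ∀ i > k ^ k', σ.h i = 0) (hr : σ.r .result = 0)
    (hcounter : Counterexample A.toNFA.accepts B.toNFA.accepts) :
    wp E O.search σ fun σ' => σ'.r .result = 0 := by
  classical
  obtain ⟨y, z, hy, hnone, hyz⟩ :=
    (counterexample_iff_exists_walk prodSize_le_searchLength).1 hcounter
  have advances (y : ProdState k k' n n') : Advances E A B fun t x r =>
      r = 0 ∧ ∃ m, t + m = searchLength k k' n n' ∧ Walk (ProdRel A B) m x y := by
    rintro t x _ ht ⟨rfl, m, hm, hxy⟩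
    obtain - | m := m
    · omega
    obtain ⟨x', ⟨hbad, v, rfl⟩, hxy⟩ := hxy
    simp only [hdem, cond_false]
    exact ⟨v, if_neg hbad, m, by omega, hxy⟩
  refine wp_mono (h.wp_search hE hs hσ (by omega) ⟨hr, _, Nat.zero_add _, hy⟩ (advances y) ?_
    (advances z)) fun σ' ⟨_, hx, _⟩ => hx
  rintro x _ ⟨rfl, m, hm, hxy⟩
  obtain rfl : m = 0 := by omega
  obtain rfl : x = y := hxy
  exact ⟨if_pos hnone, _, Nat.zero_add _, hyz⟩

end Locates

end Search

/-! ### Decision of representation-equivalence -/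

section Decision

/-- The position of the second automaton in `encodeInput`. -/
def secondPos : Expr Reg := 5 + .input 3 + .input 3 * .pow .exponent alphabetSize (.input 1)

/-- Watches the first automaton, and copies the second one. -/
def forth : Operands := ⟨.input 1, .input 2, 3, secondPos⟩

/-- Watches the second automaton, and copies the first one. -/
def back : Operands := ⟨.input 2, .input 1, secondPos, 3⟩

/-- Sets `result` to `1` if there is no counterexample, and to `0` otherwise. -/
def exploreBoth : Stm Reg := .result ≔ 1 ;; forth.explore ;; back.explore

/-- The search for a counterexample, which needs a letter. Leaves `result = 0` if it succeeds. -/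
def Operands.falsify (O : Operands) : Stm Reg := .ite O.letterCount O.search (.result ≔ 1)

/-- Guesses one of the two inclusions and falsifies it. -/
def searchBoth : Stm Reg := .guess .row 1 ;; .ite (.var .row) forth.falsify back.falsify

variable {s k k' n n' : ℕ} {E : Env} {σ : Store Reg} {A : DetAut (Fin k → Fin s) n}
  {A' : DetAut (Fin k' → Fin s) n'}

/-- A bound for the entries of the input and for the values of the registers in `searchBoth`. -/
def valueBound (s k k' n n' : ℕ) : ℕ :=
  s + k + k' + s ^ k + s ^ k' + 2 * (k ^ k' + k' ^ k) + n + n' + 3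

theorem le_of_mem_encodeAut {a : ℕ} (ha : a ∈ encodeAut A) : a ≤ n + 1 := by
  simp only [encodeAut, List.mem_cons, List.mem_append, List.mem_ofFn] at ha
  rcases ha with rfl | rfl | ⟨q, rfl⟩ | ⟨i, rfl⟩
  · omega
  · omega
  · split_ifs <;> omega
  · cases A.step _ _ with
    | none => simp
    | some q => simpa using q.isLt.le.trans n.le_succ

theorem getD_encodeInput_le (a : ℕ) :
    (encodeInput A A').getD a 0 ≤ valueBound s k k' n n' := by
  rw [valueBound, List.getD_eq_getElem?_getD]
  cases h : (encodeInput A A')[a]? with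
  | none => simp
  | some c =>
    have hmem := List.mem_of_getElem? h
    simp only [encodeInput, List.mem_cons, List.mem_append] at hmem
    rw [Option.getD_some]
    rcases hmem with rfl | rfl | rfl | h | h
    · omega
    · omega
    · omega
    · have := le_of_mem_encodeAut h
      omega
    · have := le_of_mem_encodeAut h
      omega

/-- The input of `E` consists of `A` and `A'`, and the bound for registers is large enough. -/
structure FitsInput (E : Env) (A : DetAut (Fin k → Fin s) n) (A' : DetAut (Fin k' → Fin s) n') :
    Prop where
  inp : E.inp = encodeInput A A'
  value : valueBound s k k' n n' ≤ E.Z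

namespace FitsInput

theorem yields_input (h : FitsInput E A A') (i : ℕ) :
    Yields E σ (.input (.const i)) ((encodeInput A A').getD i 0) :=
  h.inp ▸ .input (.const i)

theorem yields_secondPos (h : FitsInput E A A') : Yields E σ secondPos (5 + n + n * s ^ k) := by
  have hvalue := h.value
  rw [valueBound] at hvalue
  have hsize : (encodeInput A A').getD 3 0 = n := rfl
  have hn := hsize ▸ h.yields_input (σ := σ) 3
  exact ((yields_ofNat 5).add hn).add
    (hn.mul (.pow (by omega) (fun _ => h.yields_input 0) (h.yields_input 1)
      (show k ≤ E.Z by omega) (show s ^ k ≤ E.Z by omega)))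

theorem encodes_fst (h : FitsInput E A A') : Encodes E.inp 3 A :=
  h.inp ▸ encodes_append A [s, k, k'] (encodeAut A')

theorem encodes_snd (h : FitsInput E A A') : Encodes E.inp (5 + n + n * s ^ k) A' := by
  have hsnd := encodes_append A' ([s, k, k'] ++ encodeAut A) []
  have hlength : ([s, k, k'] ++ encodeAut A).length = 5 + n + n * s ^ k := by
    rw [List.length_append, length_encodeAut]
    simp only [List.length_cons, List.length_nil]
    omega
  rw [List.append_nil, List.append_assoc, hlength] at hsnd
  exact h.inp ▸ hsnd

theorem locates_forth (h : FitsInput E A A') : Locates E forth 3 (5 + n + n * s ^ k) A A' where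
  alphabetSize _ := h.yields_input 0
  arityA _ := h.yields_input 1
  arityB _ := h.yields_input 2
  posA _ := yields_ofNat 3
  posB _ := h.yields_secondPos
  encodesA := h.encodes_fst
  encodesB := h.encodes_snd
  bound := by
    have hvalue := h.value
    rw [valueBound] at hvalue
    omega

theorem locates_back (h : FitsInput E A A') : Locates E back (5 + n + n * s ^ k) 3 A' A where
  alphabetSize _ := h.yields_input 0
  arityA _ := h.yields_input 2
  arityB _ := h.yields_input 1
  posA _ := h.yields_secondPos
  posB _ := yields_ofNat 3
  encodesA := h.encodes_snd
  encodesB := h.encodes_fst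
  bound := by
    have hvalue := h.value
    rw [valueBound] at hvalue
    omega

theorem wp_exploreBoth (h : FitsInput E A A') (hE : FitsTable E (prodSize k k' n n'))
    (hE' : FitsTable E (prodSize k' k n' n)) :
    wp E exploreBoth σ fun σ' => σ'.r .result ≠ 0 ↔ RepEquiv A A' := by
  classical
  have := h.locates_forth.bound
  have le_one {P : Prop} [Decidable P] : (if P then 0 else 1) ≤ E.Z := by split_ifs <;> omega
  refine wp_seq (wp_assign (yields_ofNat 1) (by omega) (Eq.refl _)) ?_
  rintro _ rfl
  have hresult : (σ.set .result 1).r .result = 1 := by simp [Store.set]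
  refine wp_seq (h.locates_forth.wp_explore hE (by omega)) fun σ₁ hσ₁ => ?_
  rw [hresult] at hσ₁
  refine wp_mono (h.locates_back.wp_explore hE' (hσ₁ ▸ le_one)) fun σ₂ hσ₂ => ?_
  rw [hσ₂, hσ₁, repEquiv_iff]
  simp [and_comm]

end FitsInput

theorem Counterexample.nonempty {α : Type*} {L : Language (Fin k → α)} {L' : Language (Fin k' → α)}
    (h : Counterexample L L') : Nonempty (Fin k → α) :=
  let ⟨τ, _⟩ := h
  ⟨τ 0⟩

section Falsify

variable {O : Operands} {a b : ℕ}

theorem Locates.wp_falsify_demonic (h : Locates E O a b A A') (hE : FitsCounter E k k' n n')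
    (hdem : E.dem = true) (hσ : ∀ i, σ.h i = 0) (hr : σ.r .result = 0) :
    wp E O.falsify σ fun σ' =>
      σ'.r .result = 0 → Counterexample A.toNFA.accepts A'.toNFA.accepts := by
  have := h.bound
  refine ⟨_, h.letterCount σ, fun hs => ?_, fun _ => wp_assign (yields_ofNat 1) (by omega) ?_⟩
  · exact h.wp_search_demonic hE hdem (Nat.pos_of_ne_zero hs) (fun i _ => hσ i) (by omega)
  · simp [Store.set]

theorem Locates.wp_falsify_angelic (h : Locates E O a b A A') (hE : FitsCounter E k k' n n')
    (hdem : E.dem = false) (hσ : ∀ i, σ.h i = 0) (hr : σ.r .result = 0)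
    (hcounter : Counterexample A.toNFA.accepts A'.toNFA.accepts) :
    wp E O.falsify σ fun σ' => σ'.r .result = 0 := by
  have := hcounter.nonempty
  have hs : 0 < s ^ k := by simpa using Fintype.card_pos (α := Fin k → Fin s)
  exact ⟨_, h.letterCount σ, fun _ => h.wp_search_angelic hE hdem hs (fun i _ => hσ i) hr hcounter,
    fun h0 => absurd h0 hs.ne'⟩

end Falsify

namespace FitsInput

theorem wp_searchBoth_demonic (h : FitsInput E A A') (hE : FitsCounter E k k' n n')
    (hE' : FitsCounter E k' k n' n) (hdem : E.dem = true) :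
    wp E searchBoth ⟨fun _ => 0, fun _ => 0⟩ fun σ => σ.r .result = 0 → ¬ RepEquiv A A' := by
  have := h.locates_forth.bound
  refine ⟨1, yields_ofNat 1, by omega, ?_⟩
  rw [hdem, cond_true]
  refine fun v _ => ⟨_, .var Reg.row, fun _ => ?_, fun _ => ?_⟩
  · exact wp_mono (h.locates_forth.wp_falsify_demonic hE hdem (fun _ => rfl) rfl)
      fun σ hσ hr hrep => (repEquiv_iff.1 hrep).1 (hσ hr)
  · exact wp_mono (h.locates_back.wp_falsify_demonic hE' hdem (fun _ => rfl) rfl)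
      fun σ hσ hr hrep => (repEquiv_iff.1 hrep).2 (hσ hr)

theorem wp_searchBoth_angelic (h : FitsInput E A A') (hE : FitsCounter E k k' n n')
    (hE' : FitsCounter E k' k n' n) (hdem : E.dem = false) (hrep : ¬ RepEquiv A A') :
    wp E searchBoth ⟨fun _ => 0, fun _ => 0⟩ fun σ => σ.r .result = 0 := by
  have := h.locates_forth.bound
  refine ⟨1, yields_ofNat 1, by omega, ?_⟩
  rw [hdem, cond_false]
  by_cases hcounter : Counterexample A.toNFA.accepts A'.toNFA.accepts
  · exact ⟨1, le_rfl, _, .var Reg.row, fun _ => h.locates_forth.wp_falsify_angelic hE hdem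
      (fun _ => rfl) rfl hcounter, fun h0 => absurd h0 one_ne_zero⟩
  · have hcounter' : Counterexample A'.toNFA.accepts A.toNFA.accepts := by
      by_contra hcounter'
      exact hrep (repEquiv_iff.2 ⟨hcounter, hcounter'⟩)
    exact ⟨0, zero_le_one, _, .var Reg.row, fun h0 => absurd rfl h0,
      fun _ => h.locates_back.wp_falsify_angelic hE' hdem (fun _ => rfl) rfl hcounter'⟩

end FitsInput

end Decision

section Bounds

variable {s k k' n n' : ℕ} {P : Prog} {inp : List ℕ}

theorem monotone_eval (q : Polynomial ℕ) : Monotone fun m => q.eval m := fun a b hab => by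
  simp only [Polynomial.eval_eq_sum, Polynomial.sum]
  gcongr

theorem exists_polynomial_bound (s k k' : ℕ) : ∃ p : Polynomial ℕ, ∀ n n' : ℕ,
    valueBound s k k' n n' ≤ p.eval (n + n') ∧
    (searchLength k k' n n' + 1) * searchLength k k' n n' ≤ p.eval (n + n') ∧
    (searchLength k' k n' n + 1) * searchLength k' k n' n ≤ p.eval (n + n') := by
  open Polynomial in
  let S (e : ℕ) : ℕ[X] := (X + 2) ^ (e + 1)
  refine ⟨X + C (valueBound s k k' 0 0) + (S (k ^ k') + 1) * S (k ^ k') +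
    (S (k' ^ k) + 1) * S (k' ^ k), fun n n' => ?_⟩
  simp only [S, eval_add, eval_mul, eval_pow, eval_X, eval_C, eval_one, eval_ofNat, valueBound,
    searchLength, Nat.add_comm n' n]
  omega

theorem fitsTable_of_le {E : Env} {V S : ℕ} (hVS : V ≤ S) (hZ : (S + 1) * S ≤ E.Z)
    (hH : (S + 1) * S ≤ E.H) (hT : (S + 1) * S ≤ E.T) : FitsTable E V := by
  have hV : V ≤ (S + 1) * S := hVS.trans (Nat.le_mul_of_pos_left S S.succ_pos)
  exact ⟨hV.trans hZ, hV.trans hT, (Nat.mul_le_mul (by omega) hVS).trans hH⟩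

theorem HaltsWithin.mono {T T' : ℕ} (h : HaltsWithin P inp T) (hT : T ≤ T') :
    HaltsWithin P inp T' :=
  fun t c hr => (h t c hr).trans hT

theorem WordsAtMost.mono {W W' : ℕ} (h : WordsAtMost P inp W) (hW : W ≤ W') :
    WordsAtMost P inp W' :=
  fun t c hr a => (h t c hr a).trans hW

theorem SpaceAtMost.mono {B B' : ℝ} (h : SpaceAtMost P inp B) (hB : B ≤ B') :
    SpaceAtMost P inp B' :=
  fun t c hr a ha => h t c hr a (hB.trans ha)

theorem exists_deterministic_program : ∃ P : Prog, P.Deterministic ∧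
    ∀ s k k' : ℕ, ∃ p : Polynomial ℕ,
      ∀ (n n' : ℕ) (A : DetAut (Fin k → Fin s) n) (A' : DetAut (Fin k' → Fin s) n'),
        HaltsWithin P (encodeInput A A') (p.eval (n + n')) ∧
        WordsAtMost P (encodeInput A A') (p.eval (n + n')) ∧
        (AnswersYes P (encodeInput A A') ↔ RepEquiv A A') := by
  obtain ⟨P, C, q, hP⟩ := exploreBoth.exists_implements Reg.result
  refine ⟨P, hP.deterministic (by simp [exploreBoth, Operands.explore, Operands.sweep,
    Operands.fillRow, Stm.for, Stm.NoGuess]), fun s k k' => ?_⟩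
  obtain ⟨p, hp⟩ := exists_polynomial_bound s k k'
  refine ⟨q.comp (p + p) + (p + 2) ^ C, fun n n' A A' => ?_⟩
  obtain ⟨hvalue, hforth, hback⟩ := hp n n'
  obtain ⟨m, hm⟩ : ∃ m, m = p.eval (n + n') := ⟨_, rfl⟩
  rw [← hm] at hvalue hforth hback
  have hinp (a : ℕ) := (getD_encodeInput_le (A := A) (A' := A') a).trans hvalue
  have hwp (dem : Bool) := FitsInput.wp_exploreBoth (E := ⟨encodeInput A A', m, m, m, dem⟩)
    (σ := ⟨fun _ => 0, fun _ => 0⟩) ⟨rfl, hvalue⟩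
    (fitsTable_of_le prodSize_le_searchLength hforth hforth hforth)
    (fitsTable_of_le prodSize_le_searchLength hback hback hback)
  obtain ⟨htime, hwords, -, hanswer⟩ := hP.demonic _ m m m _ hinp (hwp true)
  obtain ⟨t, M, hrun, σ, hM, hσ⟩ := hP.angelic _ m m m _ hinp (hwp false)
  simp only [Polynomial.eval_add, Polynomial.eval_comp, Polynomial.eval_pow, Polynomial.eval_ofNat,
    ← hm]
  refine ⟨htime.mono (Nat.le_add_right _ _), hwords.mono (Nat.le_add_left _ _),
    fun hyes => hσ.1 (hM ▸ hyes t M hrun), fun hrep t M hrun => ?_⟩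
  obtain ⟨σ, hM, hσ⟩ := hanswer t M hrun
  exact hM ▸ hσ.2 hrep

theorem exists_search_program : ∃ (P : Prog) (C : ℕ), ∀ s k k' : ℕ, ∃ p : Polynomial ℕ,
    ∀ (n n' : ℕ) (A : DetAut (Fin k → Fin s) n) (A' : DetAut (Fin k' → Fin s) n'),
      HaltsWithin P (encodeInput A A') (p.eval (n + n')) ∧
      SpaceAtMost P (encodeInput A A') (C + (2 * (k ^ k' + k' ^ k) + 3) : ℕ) ∧
      WordsAtMost P (encodeInput A A') ((valueBound s k k' n n' + 2) ^ C) ∧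
      (AnswersYes P (encodeInput A A') ↔ RepEquiv A A') := by
  obtain ⟨P, C, q, hP⟩ := searchBoth.exists_implements Reg.result
  refine ⟨P, C, fun s k k' => ?_⟩
  obtain ⟨p, hp⟩ := exists_polynomial_bound s k k'
  refine ⟨q.comp (p + p), fun n n' A A' => ?_⟩
  obtain ⟨hvalue, hforth, hback⟩ := hp n n'
  rw [Polynomial.eval_comp, Polynomial.eval_add]
  generalize p.eval (n + n') = m at *
  have fits (dem : Bool) := FitsInput.mk
    (E := ⟨encodeInput A A', valueBound s k k' n n', 2 * (k ^ k' + k' ^ k) + 3, m, dem⟩) rfl le_rfl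
  have hlength := (Nat.le_mul_of_pos_left _ (Nat.succ_pos _)).trans hforth
  have hlength' := (Nat.le_mul_of_pos_left _ (Nat.succ_pos _)).trans hback
  obtain ⟨htime, hwords, hspace, hanswer⟩ := hP.demonic _ _ _ m _ getD_encodeInput_le
    ((fits true).wp_searchBoth_demonic ⟨hlength, by dsimp only; omega⟩
      ⟨hlength', by dsimp only; omega⟩ rfl)
  refine ⟨htime.mono (monotone_eval q (Nat.add_le_add_left hvalue m)), hspace, hwords,
    fun hyes => ?_, fun hrep t M hrun h0 => ?_⟩
  · by_contra hrep
    obtain ⟨t, M, hrun, σ, hM, hσ⟩ := hP.angelic _ _ _ m _ getD_encodeInput_le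
      ((fits false).wp_searchBoth_angelic ⟨hlength, by dsimp only; omega⟩
        ⟨hlength', by dsimp only; omega⟩ rfl hrep)
    exact hyes t M hrun (hM.trans hσ)
  · obtain ⟨σ, hM, hσ⟩ := hanswer t M hrun
    exact hσ (hM.symm.trans h0) hrep

theorem pow_le_max_pow_max (hk : 1 ≤ k) : k ^ k' ≤ max k k' ^ max k k' :=
  (Nat.pow_le_pow_left (le_max_left k k') k').trans
    (Nat.pow_le_pow_right (by omega) (le_max_right k k'))

theorem valueBound_add_two_le (hk : 1 ≤ k) (hk' : 1 ≤ k') (A : DetAut (Fin k → Fin s) n)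
    (A' : DetAut (Fin k' → Fin s) n') :
    valueBound s k k' n n' + 2 ≤ ((encodeInput A A').length + max k k' ^ max k k') ^ 2 := by
  have hlength : (encodeInput A A').length = n + n * s ^ k + 2 + (n' + n' * s ^ k' + 2) + 3 := by
    simp only [encodeInput, List.length_cons, List.length_append, length_encodeAut]
  have hs : s ≤ s ^ k := Nat.le_self_pow (by omega) s
  have hsk : s ^ k ≤ n * s ^ k := Nat.le_mul_of_pos_left _ A.start.pos
  have hsk' : s ^ k' ≤ n' * s ^ k' := Nat.le_mul_of_pos_left _ A'.start.pos
  have hkk' := pow_le_max_pow_max (k' := k') hk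
  have hk'k := pow_le_max_pow_max (k' := k) hk'
  rw [max_comm k' k] at hk'k
  have hmax : max k k' ≤ max k k' ^ max k k' := Nat.le_self_pow (by omega) _
  have := le_max_left k k'
  have := le_max_right k k'
  calc valueBound s k k' n n' + 2
      ≤ 9 * ((encodeInput A A').length + max k k' ^ max k k') := by
        rw [valueBound]
        omega
    _ ≤ ((encodeInput A A').length + max k k' ^ max k k') ^ 2 := by
        rw [sq]
        have := A.start.pos
        have := A'.start.pos
        exact Nat.mul_le_mul_right _ (by omega)

theorem two_rpow_mul_logb (hk : 1 ≤ k) (hk' : 1 ≤ k') (x : ℝ) :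
    (2 : ℝ) ^ (x * (max (Real.logb 2 k) (Real.logb 2 k') * max (k : ℝ) k')) =
      ((max k k' ^ max k k' : ℕ) : ℝ) ^ x := by
  have hpos {i : ℕ} (hi : 1 ≤ i) : (0 : ℝ) < i := by exact_mod_cast hi
  have hlog : max (Real.logb 2 k) (Real.logb 2 k') = Real.logb 2 (max k k' : ℕ) := by
    push_cast
    exact ((Real.strictMonoOn_logb one_lt_two).monotoneOn.map_max (hpos hk) (hpos hk')).symm
  have hmax := hpos (hk.trans (le_max_left k k'))
  rw [hlog, ← Nat.cast_max, mul_comm x, Real.rpow_mul zero_le_two, Real.rpow_mul zero_le_two,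
    Real.rpow_logb two_pos one_lt_two.ne' hmax, Real.rpow_natCast, Nat.cast_pow]

theorem spaceBound_le (hk : 1 ≤ k) (hk' : 1 ≤ k') (C : ℕ) :
    ((C + (2 * (k ^ k' + k' ^ k) + 3) : ℕ) : ℝ) ≤ (2 * C + 7 : ℕ) * 2 ^ (((2 * C + 7 : ℕ) : ℝ) *
      (max (Real.logb 2 k) (Real.logb 2 k') * max (k : ℝ) k')) := by
  rw [two_rpow_mul_logb hk hk', Real.rpow_natCast]
  norm_cast
  have hkk' := pow_le_max_pow_max (k' := k') hk
  have hk'k := pow_le_max_pow_max (k' := k) hk'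
  rw [max_comm k' k] at hk'k
  have hpow : max k k' ^ max k k' ≤ (max k k' ^ max k k') ^ (2 * C + 7) :=
    Nat.le_self_pow (by omega) _
  have hone : 1 ≤ max k k' ^ max k k' := Nat.one_le_pow _ _ (by omega)
  calc C + (2 * (k ^ k' + k' ^ k) + 3) ≤ (2 * C + 7) * max k k' ^ max k k' := by nlinarith
    _ ≤ (2 * C + 7) * (max k k' ^ max k k') ^ (2 * C + 7) := Nat.mul_le_mul_left _ hpow

end Bounds

end HyperAut

open HyperAut in
/-- Representation-equivalence of deterministic finite automata of arities `k`, `k'` is decided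
by a deterministic program in polynomial time (in the total number of states), and by an
on-the-fly search, a program with nondeterministic choices, that runs in polynomial time and
in space `2 ^ O(max (log k) (log k') * max k k')` at the same time. -/
theorem mainTheorem4 :
    (∃ P : Prog, P.Deterministic ∧
      ∀ s k k' : ℕ, 1 ≤ k → 1 ≤ k' → ∃ p : Polynomial ℕ,
        ∀ (n n' : ℕ) (A : DetAut (Fin k → Fin s) n) (A' : DetAut (Fin k' → Fin s) n'),
          HaltsWithin P (encodeInput A A') (p.eval (n + n')) ∧
          WordsAtMost P (encodeInput A A') (p.eval (n + n')) ∧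
          (AnswersYes P (encodeInput A A') ↔ RepEquiv A A')) ∧
    (∃ (P : Prog) (C : ℕ),
      ∀ s k k' : ℕ, 1 ≤ k → 1 ≤ k' → ∃ p : Polynomial ℕ,
        ∀ (n n' : ℕ) (A : DetAut (Fin k → Fin s) n) (A' : DetAut (Fin k' → Fin s) n'),
          HaltsWithin P (encodeInput A A') (p.eval (n + n')) ∧
          SpaceAtMost P (encodeInput A A')
            (C * 2 ^ ((C : ℝ) * (max (Real.logb 2 k) (Real.logb 2 k') * max (k : ℝ) k'))) ∧
          WordsAtMost P (encodeInput A A')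
            (((encodeInput A A').length + max k k' ^ max k k') ^ C) ∧
          (AnswersYes P (encodeInput A A') ↔ RepEquiv A A')) := by
  refine ⟨?_, ?_⟩
  · obtain ⟨P, hP, h⟩ := exists_deterministic_program
    exact ⟨P, hP, fun s k k' _ _ => h s k k'⟩
  · obtain ⟨P, C, h⟩ := exists_search_program
    refine ⟨P, 2 * C + 7, fun s k k' hk hk' => ?_⟩
    obtain ⟨p, hp⟩ := h s k k'
    refine ⟨p, fun n n' A A' => ?_⟩
    obtain ⟨htime, hspace, hwords, hanswer⟩ := hp n n' A A'
    refine ⟨htime, hspace.mono (spaceBound_le hk hk' C), hwords.mono ?_, hanswer⟩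
    refine (Nat.pow_le_pow_left (valueBound_add_two_le hk hk' A A') C).trans ?_
    rw [← pow_mul]
    exact Nat.pow_le_pow_right (by positivity) (by omega)
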